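/- Let $M=(0,\infty)\times\mathbb R^3$ with points $x=(t,y)$, let $a$ be a smooth, strictly positive function on $(0,\infty)$, and let $g=-dt^2+a(t)^2\,dy^2$. Let $0<t_0<t_1$, $\Sigma=\{t=t_0\}$, $M_0=(t_0,\infty)\times\mathbb R^3$, let $U_1\subset\mathbb R^3$ be bounded and $U=\{t_1\}\times U_1$. Let $g_\epsilon$, $\epsilon\in[0,1]$, be a family of $C^2$ Lorentzian metrics on $M$ (signature $(-,+,+,+)$) with $g_0=g$ such that $g_\epsilon=g$ on $U\cup\Sigma$ and such that $\epsilon\mapsto g_\epsilon-g$ is differentiable from $[0,1]$ to the Banach space $C_b^2(M_0;\mathrm{Sym}^2)$ of symmetric 2-tensors whose coordinate components and their derivatives of order $\le 2$ are continuous and bounded on $M_0$. For a metric $h$ write $\gamma_h(\cdot\,;x,\theta)$ for the maximal geodesic of $(M,h)$ with initial data $(x,\theta)$. For $v\in S^2$ (the Euclidean unit sphere) put $\theta(v)=-(1,a(t_1)^{-1}v)\in\mathbb R^{1+3}$, and for $(y,v)\in U_1\times S^2$ and $x=(t_1,y)$ define $$\tau_\epsilon=\min\{\tau>0:\ \gamma_{g_\epsilon}(\tau;x,\theta(v))\in\Sigma\},\qquad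 R_\epsilon(y,v)=\big(\dot\gamma_{g_\epsilon}(\tau_\epsilon;x,\theta(v)),\partial_t\big)_{g_\epsilon}-1 .$$ For a symmetric 2-tensor $F$ on $M$ define the light ray transform of the background metric by $$L_{t_1}F(y,v)=\int F_{lm}(\gamma(\tau))\,\dot\gamma^l(\tau)\,\dot\gamma^m(\tau)\,d\tau,\qquad \gamma=\gamma_g(\cdot\,;(t_1,y),\theta(v)),$$ the integral being over the maximal interval of existence of $\gamma$. Finally let $f(t,y)=\partial_\epsilon g_\epsilon(t,y)|_{\epsilon=0}$ for $t\in(t_0,t_1)$ and $f=0$ otherwise. Then, for all sufficiently small $\epsilon\in[0,1]$, the minimum $\tau_\epsilon$, and hence $R_\epsilon$, is well defined at every point of $U_1\times S^2$. The Lie derivative $\mathcal L_{a\partial_t}(a^{-2}f)$ exists in the classical sense off the hypersurfaces $t=t_0$ and $t=t_1$ (each of which is met by each of the above light rays of $g$ at only one parameter value). For every $(y,v)\in U_1\times S^2$ the integral on the right hand side below converges absolutely, the (one-sided) derivative on the left hand side exists, and $$\partial_\epsilon R_\epsilon(y,v)\big|_{\epsilon=0}=\frac{1}{2a(t_0)}\,L_{t_1}\big(a^2\,\mathcal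 L_{a\partial_t}(a^{-2}f)\big)(y,v).$$ Here $a^2$ and $a^{-2}$ act by multiplication by the functions $a(t)^2$ and $a(t)^{-2}$. -/

import Mathlib

open scoped ContDiff Topology ENNReal

set_option maxSynthPendingDepth 3

noncomputable section

namespace CMB

/-- Euclidean three-space. -/
abbrev Space : Type := EuclideanSpace ℝ (Fin 3)

/-- The ambient vector space `ℝ × ℝ³`, with points written `(t, y)`. It is also the tangent space
at each point. -/
abbrev ST : Type := ℝ × Space

/-- Bilinear forms on a tangent space. -/
abbrev Form : Type := ST →L[ℝ] ST →L[ℝ] ℝ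

/-- The spacetime manifold `M = (0, ∞) × ℝ³`. -/
def spacetime : Set ST := {x | 0 < x.1}

/-- The part `(t₀, ∞) × ℝ³` of the spacetime to the future of the emission surface. -/
def future (t₀ : ℝ) : Set ST := {x | t₀ < x.1}

/-- The emission surface `t = t₀`. -/
def surface (t₀ : ℝ) : Set ST := {x | x.1 = t₀}

/-- The coordinate vector `∂_t`. -/
def dt : ST := (1, 0)

/-- `B` is a symmetric bilinear form of signature `(-, +, +, +)`. -/
def IsLorentzForm (B : Form) : Prop :=
  (∀ u w : ST, B u w = B w u) ∧
    ∃ b : Module.Basis (Fin 4) ℝ ST, ∀ i j : Fin 4,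
      B (b i) (b j) = if i = j then (if i = 0 then -1 else 1) else 0

/-- The tensor square `ℓ ⊗ ℓ` of a covector. -/
def covSq (ℓ : ST →L[ℝ] ℝ) : Form := (ContinuousLinearMap.mul ℝ ℝ).bilinearComp ℓ ℓ

/-- The warped product metric `-dt² + a(t)² dy²`. -/
def flrw (a : ℝ → ℝ) (x : ST) : Form :=
  -covSq (ContinuousLinearMap.fst ℝ ℝ Space) +
    (a x.1) ^ 2 • ∑ i : Fin 3,
      covSq ((EuclideanSpace.proj i).comp (ContinuousLinearMap.snd ℝ ℝ Space))

theorem flrw_apply (a : ℝ → ℝ) (x u w : ST) :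
    flrw a x u w = -(u.1 * w.1) + (a x.1) ^ 2 * inner ℝ u.2 w.2 := by
  simp [flrw, covSq, PiLp.inner_apply, mul_comm]

section BoundedFunctions

variable {E F : Type*} [NormedAddCommGroup E] [NormedSpace ℝ E]
  [NormedAddCommGroup F] [NormedSpace ℝ F]

/-- The norm `∑_{k ≤ 2} sup_{x ∈ S} ‖D^k u(x)‖` on an open set `S`, with values in `[0, ∞]`. -/
def cbTwoNorm (S : Set E) (u : E → F) : ℝ≥0∞ :=
  ∑ k ∈ Finset.range 3, ⨆ x ∈ S, ‖iteratedFDeriv ℝ k u x‖ₑ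

/-- Membership in the Banach space `C_b²(S; F)`, for `S` open. -/
def MemCbTwo (S : Set E) (u : E → F) : Prop :=
  ContDiffOn ℝ 2 u S ∧ cbTwoNorm S u < ⊤

/-- `ε ↦ u ε` is a differentiable map from `J ⊆ ℝ` to the Banach space `C_b²(S; F)`
(with one-sided difference quotients at end points of `J`). -/
def CbTwoDifferentiableOn (J : Set ℝ) (S : Set E) (u : ℝ → E → F) : Prop :=
  (∀ ε ∈ J, MemCbTwo S (u ε)) ∧
    ∀ ε ∈ J, ∃ u' : E → F, MemCbTwo S u' ∧
      Filter.Tendsto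
        (fun δ : ℝ => cbTwoNorm S (fun x => (δ - ε)⁻¹ • (u δ x - u ε x) - u' x))
        (𝓝[J \ {ε}] ε) (𝓝 0)

end BoundedFunctions

/-- The Christoffel symbols of the first kind
`½ (∂_u g(v, w) + ∂_v g(u, w) - ∂_w g(u, v))` of the metric `g` at `x`. -/
def christoffel (g : ST → Form) (x u v w : ST) : ℝ :=
  (fderiv ℝ g x u v w + fderiv ℝ g x v u w - fderiv ℝ g x w u v) / 2

/-- `γ` restricted to the open interval `I` is a geodesic of `(M, g)`. The geodesic equation is
written with the upper index lowered by the (nondegenerate) metric. -/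
def IsGeodesicOn (g : ST → Form) (γ : ℝ → ST) (I : Set ℝ) : Prop :=
  ∀ τ ∈ I, γ τ ∈ spacetime ∧ DifferentiableAt ℝ γ τ ∧ DifferentiableAt ℝ (deriv γ) τ ∧
    ∀ w : ST, g (γ τ) (deriv (deriv γ) τ) w +
      christoffel g (γ τ) (deriv γ τ) (deriv γ τ) w = 0

/-- `γ`, on the open interval `I` containing `0`, is a geodesic with initial data `(x, θ)`. -/
def IsGeodesicFrom (g : ST → Form) (x θ : ST) (γ : ℝ → ST) (I : Set ℝ) : Prop :=
  IsOpen I ∧ I.OrdConnected ∧ 0 ∈ I ∧ IsGeodesicOn g γ I ∧ γ 0 = x ∧ deriv γ 0 = θ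

/-- The maximal interval of existence of the geodesic with initial data `(x, θ)`. -/
def geodesicDomain (g : ST → Form) (x θ : ST) : Set ℝ :=
  {τ | ∃ (γ : ℝ → ST) (I : Set ℝ), IsGeodesicFrom g x θ γ I ∧ τ ∈ I}

open Classical in
/-- The maximal geodesic `γ(·; x, θ)` of `(M, g)` with initial data `(x, θ)`. The choice is
immaterial on `geodesicDomain g x θ`, since geodesics of a `C²` metric are unique; outside it
the value is a dummy one. -/
def geodesic (g : ST → Form) (x θ : ST) (τ : ℝ) : ST :=
  if h : ∃ (γ : ℝ → ST) (I : Set ℝ), IsGeodesicFrom g x θ γ I ∧ τ ∈ I then h.choose τ else x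

/-- The velocity of `γ(·; x, θ)`. -/
def velocity (g : ST → Form) (x θ : ST) (τ : ℝ) : ST := deriv (geodesic g x θ) τ

/-- The parameters `τ > 0` at which `γ(·; x, θ)` is on the surface `t = t₀`. -/
def hits (g : ST → Form) (t₀ : ℝ) (x θ : ST) : Set ℝ :=
  {τ | 0 < τ ∧ τ ∈ geodesicDomain g x θ ∧ geodesic g x θ τ ∈ surface t₀}

/-- The first hitting parameter of the surface `t = t₀` (the least element of `hits g t₀ x θ`,
when there is one). -/
def hitTime (g : ST → Form) (t₀ : ℝ) (x θ : ST) : ℝ := sInf (hits g t₀ x θ)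

/-- The past pointing lightlike vector `θ(v) = -(1, a(t₁)⁻¹ v)`. -/
def direction (a : ℝ → ℝ) (t₁ : ℝ) (v : Space) : ST := -(1, (a t₁)⁻¹ • v)

/-- The redshift `(γ̇(τ; x, θ), ∂_t)_g - 1`, where `x = (t₁, y)`, `θ = θ(v)` and `τ` is the first
hitting parameter of the surface `t = t₀`. -/
def redshift (a : ℝ → ℝ) (t₀ t₁ : ℝ) (g : ST → Form) (y v : Space) : ℝ :=
  let x : ST := (t₁, y)
  let θ : ST := direction a t₁ v
  let τ : ℝ := hitTime g t₀ x θ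
  g (geodesic g x θ τ) (velocity g x θ τ) dt - 1

/-- The integrand `f_{lm}(γ) γ̇^l γ̇^m` of the light ray transform. -/
def rayIntegrand (g f : ST → Form) (x θ : ST) (τ : ℝ) : ℝ :=
  f (geodesic g x θ τ) (velocity g x θ τ) (velocity g x θ τ)

/-- The light ray transform `X_g f(x, θ)`; the integral is over the maximal interval of
existence of the geodesic. -/
def rayTransform (g f : ST → Form) (x θ : ST) : ℝ :=
  ∫ τ in geodesicDomain g x θ, rayIntegrand g f x θ τ

/-- The light ray transform `L_{t₁} f(y, v)` for the metric `-dt² + a(t)² dy²`. -/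
def lightRay (a : ℝ → ℝ) (t₁ : ℝ) (f : ST → Form) (y v : Space) : ℝ :=
  rayTransform (flrw a) f (t₁, y) (direction a t₁ v)

/-- The Lie derivative `(𝓛_X T)_{lm} = X^k ∂_k T_{lm} + T_{km} ∂_l X^k + T_{lk} ∂_m X^k`
of a covariant 2-tensor. -/
def lieDeriv (X : ST → ST) (T : ST → Form) (x : ST) : Form :=
  fderiv ℝ T x (X x) +
    (T x).bilinearComp (fderiv ℝ X x) (ContinuousLinearMap.id ℝ ST) +
    (T x).bilinearComp (ContinuousLinearMap.id ℝ ST) (fderiv ℝ X x)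

/-- The vector field `a ∂_t`. -/
def scaledTime (a : ℝ → ℝ) (x : ST) : ST := a x.1 • dt

/-- The tensor `f`: the derivative of `g ε` at `ε = 0`, cut off to `t₀ < t < t₁`. -/
def cutoffDeriv (t₀ t₁ : ℝ) (g : ℝ → ST → Form) (x : ST) : Form :=
  Set.indicator {z : ST | z.1 ∈ Set.Ioo t₀ t₁}
    (fun z => derivWithin (fun ε => g ε z) (Set.Icc 0 1) 0) x

/-- The tensor `a⁻² T`. -/
def scaleDown (a : ℝ → ℝ) (T : ST → Form) (x : ST) : Form := ((a x.1) ^ 2)⁻¹ • T x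

/-- The tensor `a² 𝓛_{a ∂_t} a⁻² T`. -/
def conformalLie (a : ℝ → ℝ) (T : ST → Form) (x : ST) : Form :=
  (a x.1) ^ 2 • lieDeriv (scaledTime a) (scaleDown a T) x

end CMB

end

/-!
The vector field `X = a ∂_t` is a conformal Killing field of the background `g = -dt² + a² dy²`, that
is, `𝓛_X (a⁻² g) = 0`. Along a geodesic `γ` of any metric `G` one has
`d/dτ G(γ̇, X) = ½ (𝓛_X G)(γ̇, γ̇)`; if `γ` is lightlike for `G`, the right hand side equals
`½ (a² 𝓛_X (a⁻² (G - g)))(γ̇, γ̇)` (`IsGeodesicOn.hasDerivAt_energy`). Since `X = a(t₀) ∂_t` on the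
surface `t = t₀`, integration from the observer to the surface gives an exact formula for the redshift
of `G` (`redshift_eq`): up to the redshift of the background, it is `1 / (2 a(t₀))` times the integral
of this density along the ray of `G`.

For `G = g_ε` the density is `O(ε)`, and divided by `ε` it converges uniformly to the density of
`f = ∂_ε g_ε`. So the rays of `g_ε` need not be differentiated in `ε`: it is enough that they converge
to the ray of `g`, and then the dominated convergence theorem gives the derivative
(`tendsto_integral_rayDensity`).

Convergence of the rays comes from the same conservation laws. The energy `G(γ̇, X)` and the spatial
momenta `G(γ̇, ∂_i)` are constant up to `O(δ)`, where `δ` bounds `G - g` and its first derivatives, so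
`γ̇` is within `O(δ)` of the velocity `nullField` of the background rays, a function of `t` alone
(`norm_velocity_sub_nullField_le`). This keeps `γ̇` bounded and `t` decreasing, so that the ray reaches
`t = t₀` after a bounded parameter time (`exists_reachesSurface`), uniformly in the observation point
and the direction; and by Grönwall's inequality the rays are `O(δ)`-close to each other
(`ReachesSurface.dist_le`).

Nothing is known about `G - g` below `t = t₀`. For this reason the geodesics are not obtained by a
perturbation argument: the geodesic spray is cut off outside a compact set, which gives a complete
flow, and the estimates above show that the curve leaves this set only through `t = t₀`. Uniqueness of
geodesics follows from the same cutoff, and identifies the maximal geodesic of the definitions.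
-/

noncomputable section

namespace CMB

open Set Filter

/-! ### Ordinary differential equations with a locally Lipschitz right hand side -/

section ODE

variable {E : Type*} [NormedAddCommGroup E] [NormedSpace ℝ E] [FiniteDimensional ℝ E]

/-- A `C¹` vector field on an open set can be changed away from a given compact set so as to become
globally bounded and Lipschitz. -/
theorem exists_lipschitz_bounded_eqOn {V : E → E} {Ω K : Set E} (hΩ : IsOpen Ω)
    (hV : ContDiffOn ℝ 1 V Ω) (hK : IsCompact K) (hKΩ : K ⊆ Ω) :
    ∃ (W : E → E) (C L : NNReal) (O : Set E), LipschitzWith C W ∧ (∀ x, ‖W x‖ ≤ L) ∧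
      IsOpen O ∧ K ⊆ O ∧ O ⊆ Ω ∧ EqOn W V O := by
  obtain ⟨K', hK', hKK', hK'Ω⟩ := exists_compact_between hK hΩ hKΩ
  obtain ⟨f, hf1, hf0, -⟩ := exists_contMDiffMap_one_nhds_of_subset_interior (n := (⊤ : ℕ∞))
    (modelWithCornersSelf ℝ E) hK.isClosed hKK'
  have hfs : ContDiff ℝ ∞ f := f.contMDiff.contDiff
  have hsupp : tsupport (fun x => f x • V x) ⊆ K' := by
    refine closure_minimal ?_ hK'.isClosed
    intro x hx
    by_contra h
    exact hx (by simp [hf0 x h])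
  have hcs : HasCompactSupport (fun x => f x • V x) :=
    HasCompactSupport.of_support_subset_isCompact hK' ((subset_tsupport _).trans hsupp)
  have hsm : ContDiff ℝ 1 (fun x => f x • V x) := by
    refine contMDiff_iff_contDiff.1 (contMDiff_of_tsupport fun x hx => ContDiffAt.contMDiffAt ?_)
    exact ((hfs.of_le (by exact_mod_cast le_top)).contDiffAt).smul
      (hV.contDiffAt (hΩ.mem_nhds (hK'Ω (hsupp hx))))
  obtain ⟨C, hC⟩ := ContDiff.lipschitzWith_of_hasCompactSupport hcs hsm (by simp)
  obtain ⟨L, hL⟩ := hcs.exists_bound_of_continuous hsm.continuous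
  obtain ⟨O, hO, hKO, hOf⟩ := mem_nhdsSet_iff_exists.1 hf1
  refine ⟨_, C, L.toNNReal, O ∩ Ω, hC, fun x => (hL x).trans (Real.le_coe_toNNReal L),
    hO.inter hΩ, subset_inter hKO hKΩ, inter_subset_right, fun x hx => ?_⟩
  have : f x = 1 := hOf hx.1
  simp [this]

/-- A bounded Lipschitz vector field has integral curves on arbitrarily long intervals. -/
theorem exists_hasDerivAt_of_lipschitz_of_bounded {W : E → E} {C L : NNReal}
    (hC : LipschitzWith C W) (hL : ∀ x, ‖W x‖ ≤ L) (x₀ : E) {T : ℝ} (hT : 0 < T) :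
    ∃ z : ℝ → E, z 0 = x₀ ∧ ∀ t ∈ Ioo (-T) T, HasDerivAt z (W (z t)) t := by
  have h0 : (0 : ℝ) ∈ Icc (-T) T := ⟨by linarith, hT.le⟩
  have hPL : IsPicardLindelof (fun _ => W) (⟨0, h0⟩ : Icc (-T) T) x₀ (L * T.toNNReal) 0 L C := by
    refine IsPicardLindelof.of_time_independent (fun x _ => hL x) hC.lipschitzOnWith ?_
    simp [hT.le]
  obtain ⟨z, hz0, hz⟩ := hPL.exists_eq_forall_mem_Icc_hasDerivWithinAt₀
  exact ⟨z, hz0, fun t ht => (hz t (Ioo_subset_Icc_self ht)).hasDerivAt (Icc_mem_nhds ht.1 ht.2)⟩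

theorem exists_Icc_subset_of_mem {I : Set ℝ} (hI : IsOpen I) (hc : I.OrdConnected) {s t : ℝ}
    (hs : s ∈ I) (ht : t ∈ I) : ∃ a b : ℝ, s ∈ Ioo a b ∧ t ∈ Ioo a b ∧ Icc a b ⊆ I := by
  have hmin : min s t ∈ I := by rcases min_choice s t with h | h <;> rw [h] <;> assumption
  have hmax : max s t ∈ I := by rcases max_choice s t with h | h <;> rw [h] <;> assumption
  obtain ⟨l, hl, hlI⟩ := mem_nhds_iff_exists_Ioo_subset.1 (hI.mem_nhds hmin)
  obtain ⟨l', u', hu', hu'I⟩ := mem_nhds_iff_exists_Ioo_subset.1 (hI.mem_nhds hmax)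
  obtain ⟨a, ha1, ha2⟩ := exists_between hlI.1.1
  obtain ⟨b, hb1, hb2⟩ := exists_between hu'.2
  refine ⟨a, b, ⟨ha2.trans_le (min_le_left _ _), (le_max_left _ _).trans_lt hb1⟩,
    ⟨ha2.trans_le (min_le_right _ _), (le_max_right _ _).trans_lt hb1⟩,
    hc.out (hlI.2 ⟨ha1, ha2.trans hlI.1.2⟩) (hu'I ⟨hu'.1.trans hb1, hb2⟩)⟩

/-- Integral curves of a `C¹` vector field on an open set are determined by their initial value. -/
theorem eqOn_of_hasDerivAt_of_contDiffOn {V : E → E} {Ω : Set E} (hΩ : IsOpen Ω)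
    (hV : ContDiffOn ℝ 1 V Ω) {I : Set ℝ} (hI : IsOpen I) (hc : I.OrdConnected) (h0 : (0 : ℝ) ∈ I)
    {z₁ z₂ : ℝ → E} (h₁ : ∀ t ∈ I, z₁ t ∈ Ω ∧ HasDerivAt z₁ (V (z₁ t)) t)
    (h₂ : ∀ t ∈ I, z₂ t ∈ Ω ∧ HasDerivAt z₂ (V (z₂ t)) t) (h : z₁ 0 = z₂ 0) : EqOn z₁ z₂ I := by
  intro t ht
  obtain ⟨a, b, hs, ht', hab⟩ := exists_Icc_subset_of_mem hI hc h0 ht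
  have hK : IsCompact (z₁ '' Icc a b ∪ z₂ '' Icc a b) :=
    (isCompact_Icc.image_of_continuousOn fun s hs =>
      (h₁ s (hab hs)).2.continuousAt.continuousWithinAt).union
    (isCompact_Icc.image_of_continuousOn fun s hs =>
      (h₂ s (hab hs)).2.continuousAt.continuousWithinAt)
  obtain ⟨W, C, L, O, hC, -, -, hKO, -, hWV⟩ := exists_lipschitz_bounded_eqOn hΩ hV hK (by
    rintro _ (⟨s, hs, rfl⟩ | ⟨s, hs, rfl⟩)
    exacts [(h₁ s (hab hs)).1, (h₂ s (hab hs)).1])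
  refine ODE_solution_unique_of_mem_Ioo (v := fun _ => W) (s := fun _ => univ) (K := C)
    (fun _ _ => hC.lipschitzOnWith) hs (fun s hs => ⟨?_, trivial⟩) (fun s hs => ⟨?_, trivial⟩) h ht'
  · have := Ioo_subset_Icc_self hs
    rw [hWV (hKO (Or.inl ⟨s, this, rfl⟩))]
    exact (h₁ s (hab this)).2
  · have := Ioo_subset_Icc_self hs
    rw [hWV (hKO (Or.inr ⟨s, this, rfl⟩))]
    exact (h₂ s (hab this)).2

end ODE

/-! ### The geodesic flow of a `C²` metric -/

theorem isOpen_spacetime : IsOpen spacetime := isOpen_lt continuous_const continuous_fst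

theorem isOpen_future (t₀ : ℝ) : IsOpen (future t₀) := isOpen_lt continuous_const continuous_fst

/-- A `C²` field of nondegenerate symmetric bilinear forms on the spacetime. The signature plays no
role in the theory of geodesics. -/
structure IsMetric (G : ST → Form) : Prop where
  contDiffOn : ContDiffOn ℝ 2 G spacetime
  symm : ∀ x ∈ spacetime, ∀ u w, G x u w = G x w u
  nondeg : ∀ x ∈ spacetime, ∀ u, (∀ w, G x u w = 0) → u = 0

theorem IsLorentzForm.eq_zero {B : Form} (hB : IsLorentzForm B) {u : ST}
    (hu : ∀ w, B u w = 0) : u = 0 := by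
  obtain ⟨b, hb⟩ := hB.2
  have h : ∀ j, b.repr u j = 0 := by
    intro j
    have h1 := hu (b j)
    rw [← b.sum_repr u] at h1
    simp only [map_sum, map_smul, sum_apply, smul_apply,
      hb, smul_eq_mul, mul_ite, mul_zero, Finset.sum_ite_eq', Finset.mem_univ, if_true] at h1
    split_ifs at h1 <;> simpa using h1
  rw [← b.sum_repr u]
  simp [h]

/-- The covector `w ↦ Γ(p, p, w)` of Christoffel symbols of the first kind. -/
def christoffelCovector (G : ST → Form) (x p : ST) : ST →L[ℝ] ℝ :=
  fderiv ℝ G x p p - (1 / 2 : ℝ) • ((fderiv ℝ G x).flip p).flip p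

theorem christoffelCovector_apply (G : ST → Form) (x p w : ST) :
    christoffelCovector G x p w = christoffel G x p p w := by
  simp only [christoffelCovector, christoffel, sub_apply,
    smul_apply, ContinuousLinearMap.flip_apply, smul_eq_mul]
  ring

/-- The geodesic spray of `G`, the vector field on the tangent bundle whose integral curves are the
geodesics together with their velocities. -/
def spray (G : ST → Form) (z : ST × ST) : ST × ST :=
  (z.2, -(G z.1).inverse (christoffelCovector G z.1 z.2))

theorem IsMetric.isInvertible {G : ST → Form} (hG : IsMetric G) {x : ST} (hx : x ∈ spacetime) :
    (G x).IsInvertible := by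
  have hinj : Function.Injective (G x : ST →ₗ[ℝ] (ST →L[ℝ] ℝ)) := by
    rw [injective_iff_map_eq_zero]
    intro u hu
    exact hG.nondeg x hx u fun w => by simpa using congrArg (fun f : ST →L[ℝ] ℝ => f w) hu
  have hdim : Module.finrank ℝ ST = Module.finrank ℝ (ST →L[ℝ] ℝ) := by
    rw [← (LinearMap.toContinuousLinearMap (𝕜 := ℝ) (E := ST) (F' := ℝ)).finrank_eq]
    exact (Subspace.dual_finrank_eq).symm
  refine ⟨(LinearEquiv.ofInjectiveOfFinrankEq _ hinj hdim).toContinuousLinearEquiv, ?_⟩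
  exact ContinuousLinearMap.ext fun u => ContinuousLinearMap.ext fun w => rfl

theorem IsMetric.apply_inverse {G : ST → Form} (hG : IsMetric G) {x : ST} (hx : x ∈ spacetime)
    (ℓ : ST →L[ℝ] ℝ) : G x ((G x).inverse ℓ) = ℓ := by
  have h := (hG.isInvertible hx).self_comp_inverse
  exact congrArg (fun f : (ST →L[ℝ] ℝ) →L[ℝ] (ST →L[ℝ] ℝ) => f ℓ) h

theorem IsMetric.inverse_apply {G : ST → Form} (hG : IsMetric G) {x : ST} (hx : x ∈ spacetime)
    (u : ST) : (G x).inverse (G x u) = u := by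
  have h := (hG.isInvertible hx).inverse_comp_self
  exact congrArg (fun f : ST →L[ℝ] ST => f u) h

theorem IsMetric.contDiffOn_fderiv {G : ST → Form} (hG : IsMetric G) :
    ContDiffOn ℝ 1 (fderiv ℝ G) spacetime :=
  hG.contDiffOn.fderiv_of_isOpen isOpen_spacetime (by norm_num)

/-- The part of the tangent bundle over the spacetime. -/
def phaseSpace : Set (ST × ST) := {z | z.1 ∈ spacetime}

theorem isOpen_phaseSpace : IsOpen phaseSpace := isOpen_spacetime.preimage continuous_fst

theorem IsMetric.contDiffOn_spray {G : ST → Form} (hG : IsMetric G) :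
    ContDiffOn ℝ 1 (spray G) phaseSpace := by
  have hmaps : MapsTo (Prod.fst : ST × ST → ST) phaseSpace spacetime := fun z hz => hz
  have hD : ContDiffOn ℝ 1 (fun z : ST × ST => fderiv ℝ G z.1) phaseSpace :=
    hG.contDiffOn_fderiv.comp contDiffOn_fst hmaps
  have hI : ContDiffOn ℝ 1 (fun z : ST × ST => (G z.1).inverse) phaseSpace := by
    intro z hz
    have h1 : ContDiffAt ℝ 1 ContinuousLinearMap.inverse (G z.1) :=
      (hG.isInvertible hz).contDiffAt_map_inverse
    have h2 : ContDiffAt ℝ 1 (fun z : ST × ST => G z.1) z :=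
      ((hG.contDiffOn.of_le one_le_two).contDiffAt (isOpen_spacetime.mem_nhds hz)).comp z
        contDiffAt_fst
    exact (h1.comp z h2).contDiffWithinAt
  have hF1 : ContDiffOn ℝ 1 (fun z : ST × ST => (fderiv ℝ G z.1).flip) phaseSpace :=
    (ContinuousLinearMap.flipₗᵢ ℝ ST ST (ST →L[ℝ] ℝ)).contDiff.comp_contDiffOn hD
  have hF2 : ContDiffOn ℝ 1 (fun z : ST × ST => ((fderiv ℝ G z.1).flip z.2).flip) phaseSpace :=
    (ContinuousLinearMap.flipₗᵢ ℝ ST ST ℝ).contDiff.comp_contDiffOn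
      (hF1.clm_apply contDiffOn_snd)
  have hC : ContDiffOn ℝ 1 (fun z : ST × ST => christoffelCovector G z.1 z.2) phaseSpace :=
    ((hD.clm_apply contDiffOn_snd).clm_apply contDiffOn_snd).sub
      ((hF2.clm_apply contDiffOn_snd).const_smul (1 / 2 : ℝ))
  exact contDiffOn_snd.prodMk (hI.clm_apply hC).neg

theorem IsMetric.hasDerivAt_spray {G : ST → Form} (hG : IsMetric G) {γ : ℝ → ST} {I : Set ℝ}
    (hγ : IsGeodesicOn G γ I) {τ : ℝ} (hτ : τ ∈ I) :
    (γ τ, deriv γ τ) ∈ phaseSpace ∧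
      HasDerivAt (fun s => (γ s, deriv γ s)) (spray G (γ τ, deriv γ τ)) τ := by
  obtain ⟨h1, h2, h3, h4⟩ := hγ τ hτ
  refine ⟨h1, ?_⟩
  have h5 : deriv (deriv γ) τ = -(G (γ τ)).inverse (christoffelCovector G (γ τ) (deriv γ τ)) := by
    rw [← map_neg, ← hG.inverse_apply h1 (deriv (deriv γ) τ)]
    congr 1
    refine ContinuousLinearMap.ext fun w => ?_
    rw [neg_apply, christoffelCovector_apply]
    linarith [h4 w]
  have := h2.hasDerivAt.prodMk h3.hasDerivAt
  rw [h5] at this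
  exact this

theorem IsMetric.isGeodesicOn_fst {G : ST → Form} (hG : IsMetric G) {z : ℝ → ST × ST} {I : Set ℝ}
    (hI : IsOpen I) (hz : ∀ τ ∈ I, z τ ∈ phaseSpace ∧ HasDerivAt z (spray G (z τ)) τ) :
    IsGeodesicOn G (fun τ => (z τ).1) I ∧ ∀ τ ∈ I, deriv (fun τ => (z τ).1) τ = (z τ).2 := by
  have h1 : ∀ τ ∈ I, HasDerivAt (fun τ => (z τ).1) (z τ).2 τ := fun τ hτ =>
    (hasFDerivAt_fst (p := z τ)).comp_hasDerivAt τ (hz τ hτ).2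
  have h2 : ∀ τ ∈ I, HasDerivAt (deriv fun τ => (z τ).1)
      (-(G (z τ).1).inverse (christoffelCovector G (z τ).1 (z τ).2)) τ := fun τ hτ =>
    ((hasFDerivAt_snd (p := z τ)).comp_hasDerivAt τ (hz τ hτ).2).congr_of_eventuallyEq <| by
      filter_upwards [hI.mem_nhds hτ] with s hs using (h1 s hs).deriv
  refine ⟨fun τ hτ => ⟨(hz τ hτ).1, (h1 τ hτ).differentiableAt, (h2 τ hτ).differentiableAt,
    fun w => ?_⟩, fun τ hτ => (h1 τ hτ).deriv⟩
  rw [(h2 τ hτ).deriv, (h1 τ hτ).deriv, map_neg, hG.apply_inverse (hz τ hτ).1,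
    neg_apply, christoffelCovector_apply]
  ring

/-- Geodesics with the same initial data agree. -/
theorem IsMetric.eqOn_of_isGeodesicFrom {G : ST → Form} (hG : IsMetric G) {x θ : ST}
    {γ₁ γ₂ : ℝ → ST} {I₁ I₂ : Set ℝ} (h₁ : IsGeodesicFrom G x θ γ₁ I₁)
    (h₂ : IsGeodesicFrom G x θ γ₂ I₂) : EqOn γ₁ γ₂ (I₁ ∩ I₂) := by
  obtain ⟨hI₁, hc₁, h01, hγ₁, hx₁, hθ₁⟩ := h₁
  obtain ⟨hI₂, hc₂, h02, hγ₂, hx₂, hθ₂⟩ := h₂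
  have := eqOn_of_hasDerivAt_of_contDiffOn isOpen_phaseSpace hG.contDiffOn_spray
    (hI₁.inter hI₂) (hc₁.inter hc₂) ⟨h01, h02⟩
    (fun t ht => hG.hasDerivAt_spray hγ₁ ht.1) (fun t ht => hG.hasDerivAt_spray hγ₂ ht.2)
    (by rw [hx₁, hθ₁, hx₂, hθ₂])
  exact fun t ht => congrArg Prod.fst (this ht)

theorem IsMetric.geodesic_eqOn {G : ST → Form} (hG : IsMetric G) {x θ : ST} {γ : ℝ → ST}
    {I : Set ℝ} (h : IsGeodesicFrom G x θ γ I) : EqOn (geodesic G x θ) γ I := by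
  intro τ hτ
  have hex : ∃ (γ : ℝ → ST) (I : Set ℝ), IsGeodesicFrom G x θ γ I ∧ τ ∈ I := ⟨γ, I, h, hτ⟩
  rw [geodesic, dif_pos hex]
  obtain ⟨J, hJ, hτJ⟩ := hex.choose_spec
  exact hG.eqOn_of_isGeodesicFrom hJ h ⟨hτJ, hτ⟩

/-- As soon as there is a geodesic with the given initial data, the maximal one is a geodesic. -/
theorem IsMetric.isGeodesicFrom_geodesic {G : ST → Form} (hG : IsMetric G) {x θ : ST} {γ : ℝ → ST}
    {I : Set ℝ} (h : IsGeodesicFrom G x θ γ I) :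
    IsGeodesicFrom G x θ (geodesic G x θ) (geodesicDomain G x θ) := by
  have hloc : ∀ {γ : ℝ → ST} {I : Set ℝ}, IsGeodesicFrom G x θ γ I → ∀ τ ∈ I,
      geodesic G x θ =ᶠ[𝓝 τ] γ := fun h τ hτ => by
    filter_upwards [h.1.mem_nhds hτ] with s hs using hG.geodesic_eqOn h hs
  refine ⟨?_, ?_, ⟨γ, I, h, h.2.2.1⟩, ?_, ?_, ?_⟩
  · rw [isOpen_iff_mem_nhds]
    rintro τ ⟨γ, I, h, hτ⟩
    filter_upwards [h.1.mem_nhds hτ] with s hs using ⟨γ, I, h, hs⟩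
  · refine ordConnected_of_uIcc_subset_left (x := 0) ?_
    rintro τ ⟨γ, I, h, hτ⟩ s hs
    exact ⟨γ, I, h, h.2.1.uIcc_subset h.2.2.1 hτ hs⟩
  · rintro τ ⟨γ, I, h, hτ⟩
    have h1 := hloc h τ hτ
    have h2 := h1.deriv
    obtain ⟨k1, k2, k3, k4⟩ := h.2.2.2.1 τ hτ
    rw [h1.eq_of_nhds, h2.deriv.eq_of_nhds, h2.eq_of_nhds]
    exact ⟨k1, k2.congr_of_eventuallyEq h1, k3.congr_of_eventuallyEq h2, k4⟩
  · rw [(hloc h 0 h.2.2.1).eq_of_nhds, h.2.2.2.2.1]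
  · rw [(hloc h 0 h.2.2.1).deriv_eq, h.2.2.2.2.2]

/-! ### Conservation laws along geodesics -/

/-- Along a geodesic, `d/dτ g(γ̇, X) = ½ (∂_X g)(γ̇, γ̇) + g(γ̇, Ẋ)` for every vector field `X` along
the curve. -/
theorem IsGeodesicOn.hasDerivAt_apply {G : ST → Form} (hG : IsMetric G) {γ : ℝ → ST} {I : Set ℝ}
    (hγ : IsGeodesicOn G γ I) {τ : ℝ} (hτ : τ ∈ I) {X : ℝ → ST} {X' : ST}
    (hX : HasDerivAt X X' τ) :
    HasDerivAt (fun s => G (γ s) (deriv γ s) (X s))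
      (fderiv ℝ G (γ τ) (X τ) (deriv γ τ) (deriv γ τ) / 2 + G (γ τ) (deriv γ τ) X') τ := by
  obtain ⟨h1, h2, h3, h4⟩ := hγ τ hτ
  have hD : HasDerivAt (fun s => G (γ s)) (fderiv ℝ G (γ τ) (deriv γ τ)) τ :=
    (((hG.contDiffOn.contDiffAt (isOpen_spacetime.mem_nhds h1)).differentiableAt
      (by norm_num)).hasFDerivAt).comp_hasDerivAt τ h2.hasDerivAt
  refine ((hD.clm_apply h3.hasDerivAt).clm_apply hX).congr_deriv ?_
  have := h4 (X τ)
  simp only [christoffel] at this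
  rw [add_apply]
  linarith

/-- `g(γ̇, γ̇)` is constant along geodesics. -/
theorem IsGeodesicOn.hasDerivAt_norm_sq {G : ST → Form} (hG : IsMetric G) {γ : ℝ → ST} {I : Set ℝ}
    (hγ : IsGeodesicOn G γ I) {τ : ℝ} (hτ : τ ∈ I) :
    HasDerivAt (fun s => G (γ s) (deriv γ s) (deriv γ s)) 0 τ := by
  obtain ⟨h1, h2, h3, h4⟩ := hγ τ hτ
  refine (hγ.hasDerivAt_apply hG hτ h3.hasDerivAt).congr_deriv ?_
  have := h4 (deriv γ τ)
  simp only [christoffel] at this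
  rw [hG.symm _ h1 (deriv γ τ) (deriv (deriv γ) τ)]
  linarith

/-- A geodesic which is lightlike at parameter `0` is lightlike. -/
theorem IsGeodesicFrom.norm_sq_eq_zero {G : ST → Form} (hG : IsMetric G) {x θ : ST} {γ : ℝ → ST}
    {I : Set ℝ} (h : IsGeodesicFrom G x θ γ I) (hnull : G x θ θ = 0) {τ : ℝ} (hτ : τ ∈ I) :
    G (γ τ) (deriv γ τ) (deriv γ τ) = 0 := by
  obtain ⟨hI, hc, h0, hγ, hx, hθ⟩ := h
  have := hI.is_const_of_deriv_eq_zero hc.isPreconnected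
    (fun s hs => (hγ.hasDerivAt_norm_sq hG hs).differentiableAt.differentiableWithinAt)
    (fun s hs => (hγ.hasDerivAt_norm_sq hG hs).deriv) hτ h0
  simpa only [hx, hθ, hnull] using this

/-- The quadratic form `p ↦ (a² 𝓛_{a ∂_t} (a⁻² T))(p, p)` at time `t`, in terms of the value `B` and
the derivative `B'` of the tensor field `T`. -/
def conformalQuad (a : ℝ → ℝ) (t : ℝ) (B : Form) (B' : ST →L[ℝ] Form) (p : ST) : ℝ :=
  a t * B' dt p p + deriv a t * p.1 * (B dt p + B p dt) - 2 * deriv a t * B p p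

theorem hasFDerivAt_scaledTime {a : ℝ → ℝ} {x : ST} (ha : DifferentiableAt ℝ a x.1) :
    HasFDerivAt (scaledTime a)
      ((deriv a x.1 • ContinuousLinearMap.fst ℝ ℝ Space).smulRight dt) x :=
  (ha.hasDerivAt.comp_hasFDerivAt x hasFDerivAt_fst).smul_const dt

theorem hasFDerivAt_scaleDown {a : ℝ → ℝ} {x : ST} (ha : DifferentiableAt ℝ a x.1)
    (ha0 : a x.1 ≠ 0) {T : ST → Form} (hT : DifferentiableAt ℝ T x) :
    HasFDerivAt (scaleDown a T)
      (((a x.1) ^ 2)⁻¹ • fderiv ℝ T x +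
        ((-(2 * a x.1 * deriv a x.1) / ((a x.1) ^ 2) ^ 2) •
          ContinuousLinearMap.fst ℝ ℝ Space).smulRight (T x)) x := by
  have h1 : HasDerivAt (fun t => ((a t) ^ 2)⁻¹)
      (-(2 * a x.1 * deriv a x.1) / ((a x.1) ^ 2) ^ 2) x.1 := by
    simpa using! (ha.hasDerivAt.pow 2).inv (pow_ne_zero 2 ha0)
  exact (h1.comp_hasFDerivAt x hasFDerivAt_fst).smul hT.hasFDerivAt

/-- The term `-2 a' T(p, p)` of `conformalQuad` comes from differentiating the factor `a⁻²`. -/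
theorem conformalLie_apply {a : ℝ → ℝ} {x : ST} (ha : DifferentiableAt ℝ a x.1)
    (ha0 : a x.1 ≠ 0) {T : ST → Form} (hT : DifferentiableAt ℝ T x) (p : ST) :
    conformalLie a T x p p = conformalQuad a x.1 (T x) (fderiv ℝ T x) p := by
  have h1 := (hasFDerivAt_scaledTime ha).fderiv
  have h2 := (hasFDerivAt_scaleDown ha ha0 hT).fderiv
  have h3 : scaledTime a x = a x.1 • dt := rfl
  simp only [conformalLie, lieDeriv, h1, h2, h3, smul_apply, add_apply,
    ContinuousLinearMap.bilinearComp_apply, ContinuousLinearMap.smulRight_apply, map_smul,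
    ContinuousLinearMap.coe_fst', ContinuousLinearMap.id_apply, smul_eq_mul, scaleDown,
    conformalQuad]
  have hdt : (dt : ST).1 = 1 := rfl
  rw [hdt]
  field_simp
  ring

theorem conformalQuad_add (a : ℝ → ℝ) (t : ℝ) (B₁ B₂ : Form) (B₁' B₂' : ST →L[ℝ] Form) (p : ST) :
    conformalQuad a t (B₁ + B₂) (B₁' + B₂') p =
      conformalQuad a t B₁ B₁' p + conformalQuad a t B₂ B₂' p := by
  simp only [conformalQuad, add_apply]
  ring

theorem conformalQuad_smul (a : ℝ → ℝ) (t c : ℝ) (B : Form) (B' : ST →L[ℝ] Form) (p : ST) :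
    conformalQuad a t (c • B) (c • B') p = c * conformalQuad a t B B' p := by
  simp only [conformalQuad, smul_apply, smul_eq_mul]
  ring

theorem abs_form_le (B : Form) {b : ℝ} (hB : ‖B‖ ≤ b) (p q : ST) :
    |B p q| ≤ b * (‖p‖ * ‖q‖) := by
  have h := B.le_opNorm₂ p q
  rw [Real.norm_eq_abs, mul_assoc] at h
  exact h.trans (mul_le_mul_of_nonneg_right hB (by positivity))

theorem norm_dt : ‖dt‖ = 1 := by simp [dt, Prod.norm_def]

theorem abs_conformalQuad_le {a : ℝ → ℝ} {t A A' b P : ℝ} (hA : |a t| ≤ A) (hA' : |deriv a t| ≤ A')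
    {B : Form} {B' : ST →L[ℝ] Form} (hB : ‖B‖ ≤ b) (hB' : ‖B'‖ ≤ b) {p : ST} (hp : ‖p‖ ≤ P) :
    |conformalQuad a t B B' p| ≤ (A + 4 * A') * b * P ^ 2 := by
  have hb : 0 ≤ b := (norm_nonneg _).trans hB
  have hP : 0 ≤ P := (norm_nonneg _).trans hp
  have hA0 : 0 ≤ A := (abs_nonneg _).trans hA
  have hA'0 : 0 ≤ A' := (abs_nonneg _).trans hA'
  have hpp : ‖p‖ * ‖p‖ ≤ P ^ 2 := by rw [sq]; gcongr
  have h1 : |B' dt p p| ≤ b * P ^ 2 := by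
    have h2 : ‖B' dt‖ ≤ b := by
      have := B'.le_opNorm dt
      rw [norm_dt, mul_one] at this
      exact this.trans hB'
    exact (abs_form_le _ h2 p p).trans (by gcongr)
  have h2 : |B dt p| ≤ b * P := by
    have := abs_form_le B hB dt p
    rw [norm_dt, one_mul] at this
    exact this.trans (by gcongr)
  have h3 : |B p dt| ≤ b * P := by
    have := abs_form_le B hB p dt
    rw [norm_dt, mul_one] at this
    exact this.trans (by gcongr)
  have h4 : |B p p| ≤ b * P ^ 2 := (abs_form_le B hB p p).trans (by gcongr)
  have h5 : |p.1| ≤ P := (norm_fst_le p).trans hp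
  have h6 : |B dt p + B p dt| ≤ 2 * (b * P) := (abs_add_le _ _).trans (by linarith)
  calc |conformalQuad a t B B' p|
      ≤ |a t * B' dt p p| + |deriv a t * p.1 * (B dt p + B p dt)| + |2 * deriv a t * B p p| := by
        exact (abs_sub _ _).trans (by gcongr; exact abs_add_le _ _)
    _ = |a t| * |B' dt p p| + |deriv a t| * |p.1| * |B dt p + B p dt|
          + 2 * |deriv a t| * |B p p| := by simp only [abs_mul, abs_two]
    _ ≤ A * (b * P ^ 2) + A' * P * (2 * (b * P)) + 2 * A' * (b * P ^ 2) := by gcongr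
    _ = (A + 4 * A') * b * P ^ 2 := by ring

/-! ### The background metric -/

theorem hasFDerivAt_flrw {a : ℝ → ℝ} {x : ST} (ha : DifferentiableAt ℝ a x.1) :
    HasFDerivAt (flrw a)
      (((2 * a x.1 * deriv a x.1) • ContinuousLinearMap.fst ℝ ℝ Space).smulRight
        (∑ i : Fin 3,
          covSq ((EuclideanSpace.proj i).comp (ContinuousLinearMap.snd ℝ ℝ Space)))) x := by
  have h1 : HasDerivAt (fun t => (a t) ^ 2) (2 * a x.1 * deriv a x.1) x.1 := by
    simpa using! ha.hasDerivAt.pow 2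
  exact ((h1.comp_hasFDerivAt x hasFDerivAt_fst).smul_const _).const_add _

theorem fderiv_flrw_apply {a : ℝ → ℝ} {x : ST} (ha : DifferentiableAt ℝ a x.1) (w u u' : ST) :
    fderiv ℝ (flrw a) x w u u' = 2 * a x.1 * deriv a x.1 * w.1 * inner ℝ u.2 u'.2 := by
  rw [(hasFDerivAt_flrw ha).fderiv]
  simp [covSq, PiLp.inner_apply, mul_comm]

/-- The vector field `a ∂_t` is a conformal Killing field of the background metric. -/
theorem conformalQuad_flrw {a : ℝ → ℝ} {x : ST} (ha : DifferentiableAt ℝ a x.1) (p : ST) :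
    conformalQuad a x.1 (flrw a x) (fderiv ℝ (flrw a) x) p = 0 := by
  simp only [conformalQuad, fderiv_flrw_apply ha, flrw_apply]
  have h1 : (dt : ST).1 = 1 := rfl
  have h2 : (dt : ST).2 = 0 := rfl
  rw [h1, h2, inner_zero_left, inner_zero_right]
  ring

/-- Along a lightlike geodesic of `G`, the derivative of `G(γ̇, a ∂_t)` only sees the deviation of `G`
from the background metric. -/
theorem IsGeodesicOn.hasDerivAt_energy {a : ℝ → ℝ} {G : ST → Form} (hG : IsMetric G) {γ : ℝ → ST}
    {I : Set ℝ} (hγ : IsGeodesicOn G γ I) {τ : ℝ} (hτ : τ ∈ I)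
    (ha : DifferentiableAt ℝ a (γ τ).1) (hnull : G (γ τ) (deriv γ τ) (deriv γ τ) = 0) :
    HasDerivAt (fun s => G (γ s) (deriv γ s) (a (γ s).1 • dt))
      (conformalQuad a (γ τ).1 (G (γ τ) - flrw a (γ τ))
        (fderiv ℝ (fun x => G x - flrw a x) (γ τ)) (deriv γ τ) / 2) τ := by
  obtain ⟨h1, h2, h3, h4⟩ := hγ τ hτ
  have hGd : DifferentiableAt ℝ G (γ τ) :=
    (hG.contDiffOn.contDiffAt (isOpen_spacetime.mem_nhds h1)).differentiableAt (by norm_num)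
  have hX : HasDerivAt (fun s => a (γ s).1 • dt) ((deriv a (γ τ).1 * (deriv γ τ).1) • dt) τ := by
    have h5 : HasDerivAt (fun s => (γ s).1) (deriv γ τ).1 τ :=
      (hasFDerivAt_fst (p := γ τ)).comp_hasDerivAt τ h2.hasDerivAt
    exact (ha.hasDerivAt.comp τ h5).smul_const dt
  refine (hγ.hasDerivAt_apply hG hτ hX).congr_deriv ?_
  have h6 : fderiv ℝ (fun x => G x - flrw a x) (γ τ) = fderiv ℝ G (γ τ) - fderiv ℝ (flrw a) (γ τ) :=
    fderiv_fun_sub hGd (hasFDerivAt_flrw ha).differentiableAt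
  have h7 := conformalQuad_add a (γ τ).1 (G (γ τ) - flrw a (γ τ)) (flrw a (γ τ))
    (fderiv ℝ G (γ τ) - fderiv ℝ (flrw a) (γ τ)) (fderiv ℝ (flrw a) (γ τ)) (deriv γ τ)
  rw [conformalQuad_flrw ha, add_zero, sub_add_cancel, sub_add_cancel] at h7
  rw [h6, ← h7, conformalQuad, hnull, hG.symm _ h1 dt (deriv γ τ)]
  simp only [map_smul, smul_apply, smul_eq_mul]
  ring

/-- Along a geodesic of `G`, the derivative of the momentum in a spatial direction only sees the
deviation of `G` from the background metric. -/
theorem IsGeodesicOn.hasDerivAt_momentum {a : ℝ → ℝ} {G : ST → Form} (hG : IsMetric G) {γ : ℝ → ST}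
    {I : Set ℝ} (hγ : IsGeodesicOn G γ I) {τ : ℝ} (hτ : τ ∈ I)
    (ha : DifferentiableAt ℝ a (γ τ).1) (w : Space) :
    HasDerivAt (fun s => G (γ s) (deriv γ s) (0, w))
      (fderiv ℝ (fun x => G x - flrw a x) (γ τ) (0, w) (deriv γ τ) (deriv γ τ) / 2) τ := by
  have hGd : DifferentiableAt ℝ G (γ τ) :=
    (hG.contDiffOn.contDiffAt (isOpen_spacetime.mem_nhds (hγ τ hτ).1)).differentiableAt
      (by norm_num)
  refine (hγ.hasDerivAt_apply hG hτ (hasDerivAt_const τ ((0, w) : ST))).congr_deriv ?_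
  rw [fderiv_fun_sub hGd (hasFDerivAt_flrw ha).differentiableAt, sub_apply, sub_apply, sub_apply,
    fderiv_flrw_apply ha]
  simp

theorem flrw_direction {a : ℝ → ℝ} {t₁ : ℝ} (ha : a t₁ ≠ 0) {v : Space} (hv : ‖v‖ = 1)
    (y : Space) : flrw a (t₁, y) (direction a t₁ v) (direction a t₁ v) = 0 := by
  rw [flrw_apply]
  have h1 : (direction a t₁ v).1 = -1 := rfl
  have h2 : (direction a t₁ v).2 = -((a t₁)⁻¹ • v) := rfl
  rw [h1, h2, real_inner_self_eq_norm_sq, norm_neg, norm_smul, hv, mul_one, norm_inv, inv_pow,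
    Real.norm_eq_abs, sq_abs]
  field_simp
  ring

/-! ### Lightlike geodesics of metrics close to the background -/

/-- The velocity at time `t` of the past pointing lightlike geodesics of the background metric with
initial velocity `direction a t₁ v` at time `t₁`. -/
def nullField (a : ℝ → ℝ) (t₁ : ℝ) (v : Space) (t : ℝ) : ST :=
  (-(a t₁ / a t), -((a t₁ / (a t) ^ 2) • v))

/-- Bounds for the scale factor on the slab `t₀ ≤ t ≤ t₁ + 1`. -/
structure SlabBounds (a : ℝ → ℝ) (t₀ t₁ m A A' : ℝ) : Prop where
  pos : 0 < t₀
  lt : t₀ < t₁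
  differentiableAt : ∀ t, 0 < t → DifferentiableAt ℝ a t
  m_pos : 0 < m
  le_a : ∀ t ∈ Icc t₀ (t₁ + 1), m ≤ a t
  a_le : ∀ t ∈ Icc t₀ (t₁ + 1), a t ≤ A
  deriv_le : ∀ t ∈ Icc t₀ (t₁ + 1), |deriv a t| ≤ A'

/-- `G` and its first derivatives differ from the background by at most `δ` on `t > t₀`. -/
def IsClose (a : ℝ → ℝ) (t₀ : ℝ) (G : ST → Form) (δ : ℝ) : Prop :=
  ∀ x ∈ future t₀, ‖G x - flrw a x‖ ≤ δ ∧ ‖fderiv ℝ (fun x => G x - flrw a x) x‖ ≤ δ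

theorem exists_slabBounds {a : ℝ → ℝ} (ha : ContDiffOn ℝ ∞ a (Ioi 0)) (ha_pos : ∀ t, 0 < t → 0 < a t)
    {t₀ t₁ : ℝ} (ht₀ : 0 < t₀) (ht₁ : t₀ < t₁) : ∃ m A A', SlabBounds a t₀ t₁ m A A' := by
  have hsub : Icc t₀ (t₁ + 1) ⊆ Ioi 0 := fun t ht => ht₀.trans_le ht.1
  have hne : (Icc t₀ (t₁ + 1)).Nonempty := nonempty_Icc.2 (by linarith)
  have hc : ContinuousOn a (Icc t₀ (t₁ + 1)) := ha.continuousOn.mono hsub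
  have hc' : ContinuousOn (deriv a) (Icc t₀ (t₁ + 1)) :=
    (ha.continuousOn_deriv_of_isOpen isOpen_Ioi (by simp)).mono hsub
  obtain ⟨s, hs, hs'⟩ := isCompact_Icc.exists_isMinOn hne hc
  obtain ⟨A, hA⟩ := isCompact_Icc.exists_bound_of_continuousOn hc
  obtain ⟨A', hA'⟩ := isCompact_Icc.exists_bound_of_continuousOn hc'
  exact ⟨a s, A, A', ht₀, ht₁, fun t ht =>
    (ha.contDiffAt (Ioi_mem_nhds ht)).differentiableAt (by simp), ha_pos s (hsub hs),
    fun t ht => hs' ht, fun t ht => (le_abs_self _).trans (hA t ht), fun t ht => hA' t ht⟩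

namespace SlabBounds

variable {a : ℝ → ℝ} {t₀ t₁ m A A' : ℝ}

theorem a_pos (h : SlabBounds a t₀ t₁ m A A') {t : ℝ} (ht : t ∈ Icc t₀ (t₁ + 1)) : 0 < a t :=
  h.m_pos.trans_le (h.le_a t ht)

theorem mem_t₁ (h : SlabBounds a t₀ t₁ m A A') : t₁ ∈ Icc t₀ (t₁ + 1) := ⟨h.lt.le, by linarith⟩

theorem A_pos (h : SlabBounds a t₀ t₁ m A A') : 0 < A :=
  (h.a_pos h.mem_t₁).trans_le (h.a_le _ h.mem_t₁)

theorem abs_a_le (h : SlabBounds a t₀ t₁ m A A') {t : ℝ} (ht : t ∈ Icc t₀ (t₁ + 1)) : |a t| ≤ A := by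
  rw [abs_of_pos (h.a_pos ht)]
  exact h.a_le t ht

theorem A'_nonneg (h : SlabBounds a t₀ t₁ m A A') : 0 ≤ A' :=
  (abs_nonneg _).trans (h.deriv_le _ h.mem_t₁)

theorem nullField_fst_le (h : SlabBounds a t₀ t₁ m A A') (v : Space) {t : ℝ}
    (ht : t ∈ Icc t₀ (t₁ + 1)) : (nullField a t₁ v t).1 ≤ -(m / A) := by
  have : m / A ≤ a t₁ / a t :=
    div_le_div₀ (h.a_pos h.mem_t₁).le (h.le_a _ h.mem_t₁) (h.a_pos ht) (h.a_le t ht)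
  exact neg_le_neg this

theorem norm_nullField_le (h : SlabBounds a t₀ t₁ m A A') {v : Space} (hv : ‖v‖ = 1) {t : ℝ}
    (ht : t ∈ Icc t₀ (t₁ + 1)) : ‖nullField a t₁ v t‖ ≤ A / m + A / m ^ 2 := by
  have h0 := h.m_pos
  have h1 := h.A_pos
  have ha1 := h.a_pos h.mem_t₁
  have ha := h.a_pos ht
  have h2 : a t₁ / a t ≤ A / m :=
    div_le_div₀ h1.le (h.a_le _ h.mem_t₁) h0 (h.le_a t ht)
  have h3 : a t₁ / (a t) ^ 2 ≤ A / m ^ 2 :=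
    div_le_div₀ h1.le (h.a_le _ h.mem_t₁) (by positivity)
      (pow_le_pow_left₀ h0.le (h.le_a t ht) 2)
  have h4 : 0 ≤ A / m := by positivity
  have h5 : 0 ≤ A / m ^ 2 := by positivity
  rw [nullField, Prod.norm_mk, norm_neg, norm_neg, norm_smul, hv, mul_one, Real.norm_eq_abs,
    Real.norm_eq_abs, abs_of_pos (by positivity), abs_of_pos (by positivity)]
  exact max_le (by linarith) (by linarith)

theorem nullField_t₁ (h : SlabBounds a t₀ t₁ m A A') (v : Space) :
    nullField a t₁ v t₁ = direction a t₁ v := by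
  have ha1 := (h.a_pos h.mem_t₁).ne'
  have h1 : a t₁ / (a t₁) ^ 2 = (a t₁)⁻¹ := by field_simp
  rw [nullField, h1, div_self ha1]
  rfl

end SlabBounds

/-- The constant in the comparison of velocities, for geodesics of speed at most `B` during a
parameter interval of length at most `T`. -/
def deviationConst (m A A' B T : ℝ) : ℝ :=
  (B ^ 2 * T / 2 + B) / m ^ 2 + ((A + 4 * A') * B ^ 2 * T / 2 + A * B) / m

/-- Since energy and momentum are conserved up to an error of order `δ`, the velocity of a lightlike
geodesic of a metric `δ`-close to the background is, up to such an error, the one which a lightlike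
geodesic of the background has at the same time `t`. -/
theorem norm_velocity_sub_nullField_le {a : ℝ → ℝ} {t₀ t₁ m A A' δ B T : ℝ}
    (hs : SlabBounds a t₀ t₁ m A A') {G : ST → Form} (hG : IsMetric G) (hδ : IsClose a t₀ G δ)
    {y v : Space} (hv : ‖v‖ = 1) (hy : G (t₁, y) = flrw a (t₁, y)) {γ : ℝ → ST} {I : Set ℝ}
    (hγ : IsGeodesicFrom G (t₁, y) (direction a t₁ v) γ I) {τ : ℝ} (hτ0 : 0 ≤ τ) (hτT : τ ≤ T)
    (hI : Icc 0 τ ⊆ I) (hslab : ∀ r ∈ Icc 0 τ, (γ r).1 ∈ Ioc t₀ (t₁ + 1))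
    (hB : ∀ r ∈ Icc 0 τ, ‖deriv γ r‖ ≤ B) :
    ‖deriv γ τ - nullField a t₁ v (γ τ).1‖ ≤ deviationConst m A A' B T * δ := by
  have hτ : τ ∈ Icc 0 τ := ⟨hτ0, le_rfl⟩
  have h0 : (0 : ℝ) ∈ Icc 0 τ := ⟨le_rfl, hτ0⟩
  have hmem : ∀ r ∈ Icc 0 τ, (γ r).1 ∈ Icc t₀ (t₁ + 1) := fun r hr => Ioc_subset_Icc_self (hslab r hr)
  have hB0 : 0 ≤ B := (norm_nonneg _).trans (hB τ hτ)
  have hT0 : 0 ≤ T := hτ0.trans hτT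
  have hδ0 : 0 ≤ δ := (norm_nonneg _).trans (hδ _ (hslab τ hτ).1).1
  have hm := hs.m_pos
  have hA := hs.A_pos
  have hA' := hs.A'_nonneg
  have ha1 := hs.a_pos hs.mem_t₁
  have haτ := hs.a_pos (hmem τ hτ)
  have hamτ := hs.le_a _ (hmem τ hτ)
  have hd : ∀ r ∈ Icc 0 τ, DifferentiableAt ℝ a (γ r).1 := fun r hr =>
    hs.differentiableAt _ (hs.pos.trans (hslab r hr).1)
  have hnull : ∀ r ∈ Icc 0 τ, G (γ r) (deriv γ r) (deriv γ r) = 0 := fun r hr =>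
    hγ.norm_sq_eq_zero hG (by rw [hy]; exact flrw_direction ha1.ne' hv y) (hI hr)
  have hgeo := hγ.2.2.2.1
  have hγ0 : γ 0 = (t₁, y) := hγ.2.2.2.2.1
  have hγ'0 : deriv γ 0 = direction a t₁ v := hγ.2.2.2.2.2
  set p := deriv γ τ with hp
  set H := G (γ τ) - flrw a (γ τ) with hH
  have hHn : ‖H‖ ≤ δ := (hδ _ (hslab τ hτ).1).1
  have hGH : ∀ u w, G (γ τ) u w = flrw a (γ τ) u w + H u w := fun u w => by
    simp only [hH, sub_apply]; ring
  -- the momentum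
  have hmom : ∀ w : Space, |inner ℝ ((a (γ τ).1) ^ 2 • p.2 + a t₁ • v) w| ≤
      (B ^ 2 * T / 2 + B) * δ * ‖w‖ := by
    intro w
    have hw : ‖((0, w) : ST)‖ = ‖w‖ := by simp [Prod.norm_def]
    have h1 := norm_image_sub_le_of_norm_deriv_le_segment' (C := δ * ‖w‖ * B ^ 2 / 2)
      (fun r hr => (hgeo.hasDerivAt_momentum hG (hI hr) (hd r hr) w).hasDerivWithinAt)
      (fun r hr => by
        have hr' := Ico_subset_Icc_self hr
        have h2 : ‖fderiv ℝ (fun x => G x - flrw a x) (γ r) (0, w)‖ ≤ δ * ‖w‖ := by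
          have := ContinuousLinearMap.le_opNorm (fderiv ℝ (fun x => G x - flrw a x) (γ r)) (0, w)
          rw [hw] at this
          exact this.trans (by gcongr; exact (hδ _ (hslab r hr').1).2)
        have h3 := abs_form_le _ h2 (deriv γ r) (deriv γ r)
        rw [Real.norm_eq_abs, abs_div, abs_two]
        gcongr
        refine h3.trans ?_
        rw [sq]
        gcongr <;> exact hB r hr') τ hτ
    rw [hγ0, hγ'0, hy, flrw_apply, hGH, flrw_apply, Real.norm_eq_abs, sub_zero] at h1
    have h4 : |H p (0, w)| ≤ δ * (B * ‖w‖) := by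
      have := abs_form_le H hHn p (0, w)
      rw [hw] at this
      exact this.trans (by gcongr; exact hB τ hτ)
    have h5 : (direction a t₁ v).2 = -((a t₁)⁻¹ • v) := rfl
    have h6 : inner ℝ ((a (γ τ).1) ^ 2 • p.2 + a t₁ • v) w =
        (-(p.1 * ((0, w) : ST).1) + (a (γ τ).1) ^ 2 * inner ℝ p.2 ((0, w) : ST).2 + H p (0, w) -
          (-((direction a t₁ v).1 * ((0, w) : ST).1) +
            (a ((t₁, y) : ST).1) ^ 2 * inner ℝ (direction a t₁ v).2 ((0, w) : ST).2)) -
          H p (0, w) := by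
      rw [h5, inner_neg_left, inner_smul_left, inner_add_left, inner_smul_left, inner_smul_left]
      simp only [conj_trivial]
      field_simp
      ring
    rw [h6]
    refine (abs_sub _ _).trans ((add_le_add h1 h4).trans ?_)
    have : δ * ‖w‖ * B ^ 2 / 2 * τ ≤ δ * ‖w‖ * B ^ 2 / 2 * T := by gcongr
    linarith
  -- testing against the vector itself
  have hmom' : ‖(a (γ τ).1) ^ 2 • p.2 + a t₁ • v‖ ≤ (B ^ 2 * T / 2 + B) * δ := by
    have h1 := hmom ((a (γ τ).1) ^ 2 • p.2 + a t₁ • v)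
    rw [real_inner_self_eq_norm_mul_norm, abs_of_nonneg (by positivity)] at h1
    by_contra! h2
    have h3 : 0 < ‖(a (γ τ).1) ^ 2 • p.2 + a t₁ • v‖ := lt_of_le_of_lt (by positivity) h2
    exact absurd h1 (not_le.2 (mul_lt_mul_of_pos_right h2 h3))
  -- the energy
  have hen : |a (γ τ).1 * p.1 + a t₁| ≤ ((A + 4 * A') * B ^ 2 * T / 2 + A * B) * δ := by
    have h1 := norm_image_sub_le_of_norm_deriv_le_segment' (C := (A + 4 * A') * δ * B ^ 2 / 2)
      (fun r hr =>
        (hgeo.hasDerivAt_energy hG (hI hr) (hd r hr) (hnull r hr)).hasDerivWithinAt)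
      (fun r hr => by
        have hr' := Ico_subset_Icc_self hr
        rw [Real.norm_eq_abs, abs_div, abs_two]
        gcongr
        exact abs_conformalQuad_le (hs.abs_a_le (hmem r hr')) (hs.deriv_le _ (hmem r hr'))
          (hδ _ (hslab r hr').1).1 (hδ _ (hslab r hr').1).2 (hB r hr')) τ hτ
    rw [hγ0, hγ'0, hy, map_smul, map_smul, hGH, flrw_apply, flrw_apply, Real.norm_eq_abs,
      sub_zero] at h1
    have h4 : |H p dt| ≤ δ * B := by
      have := abs_form_le H hHn p dt
      rw [norm_dt, mul_one] at this
      exact this.trans (by gcongr; exact hB τ hτ)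
    have h5 : a (γ τ).1 * p.1 + a t₁ = a (γ τ).1 * H p dt -
        (a (γ τ).1 • (-(p.1 * (dt : ST).1) + (a (γ τ).1) ^ 2 * inner ℝ p.2 (dt : ST).2 + H p dt) -
          a ((t₁, y) : ST).1 • (-((direction a t₁ v).1 * (dt : ST).1) +
            (a ((t₁, y) : ST).1) ^ 2 * inner ℝ (direction a t₁ v).2 (dt : ST).2)) := by
      have h6 : (dt : ST).1 = 1 := rfl
      have h7 : (dt : ST).2 = 0 := rfl
      have h8 : (direction a t₁ v).1 = -1 := rfl
      simp only [h6, h7, h8, inner_zero_right, smul_eq_mul]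
      ring
    rw [h5]
    refine (abs_sub _ _).trans ((add_le_add (b := A * (δ * B)) ?_ h1).trans ?_)
    · rw [abs_mul]
      gcongr
      exact hs.abs_a_le (hmem τ hτ)
    · have : (A + 4 * A') * δ * B ^ 2 / 2 * τ ≤ (A + 4 * A') * δ * B ^ 2 / 2 * T := by gcongr
      linarith
  have h1 : ‖(p - nullField a t₁ v (γ τ).1).1‖ ≤
      ((A + 4 * A') * B ^ 2 * T / 2 + A * B) / m * δ := by
    have h2 : (p - nullField a t₁ v (γ τ).1).1 = (a (γ τ).1 * p.1 + a t₁) / a (γ τ).1 := by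
      simp only [nullField, Prod.fst_sub]
      field_simp
      ring
    rw [h2, Real.norm_eq_abs, abs_div, abs_of_pos haτ, div_mul_eq_mul_div]
    exact div_le_div₀ (by positivity) hen hm hamτ
  have h2 : ‖(p - nullField a t₁ v (γ τ).1).2‖ ≤ (B ^ 2 * T / 2 + B) / m ^ 2 * δ := by
    have h3 : (p - nullField a t₁ v (γ τ).1).2 =
        ((a (γ τ).1) ^ 2)⁻¹ • ((a (γ τ).1) ^ 2 • p.2 + a t₁ • v) := by
      simp only [nullField, Prod.snd_sub]
      rw [smul_add, smul_smul, smul_smul, inv_mul_cancel₀ (by positivity), one_smul, sub_neg_eq_add,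
        div_eq_inv_mul]
    rw [h3, norm_smul, norm_inv, norm_pow, Real.norm_eq_abs, abs_of_pos haτ, ← div_eq_inv_mul,
      div_mul_eq_mul_div]
    exact div_le_div₀ (by positivity) hmom' (by positivity) (pow_le_pow_left₀ hm.le hamτ 2)
  have h3 : 0 ≤ ((A + 4 * A') * B ^ 2 * T / 2 + A * B) / m * δ := by positivity
  have h4 : 0 ≤ (B ^ 2 * T / 2 + B) / m ^ 2 * δ := by positivity
  rw [Prod.norm_def, deviationConst, add_mul]
  exact max_le (by linarith) (by linarith)

/-- The curve `γ` on `I` reaches `t = t₀` for the first time at `s`. Before, it stays in the slab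
`t₀ < t ≤ t₁`, and its velocity is bounded by `B`, decreases `t` at a rate of at least `c`, and is
within `e` of the velocity for the background. -/
structure ReachesSurface (a : ℝ → ℝ) (t₀ t₁ : ℝ) (v : Space) (B c e : ℝ) (γ : ℝ → ST) (I : Set ℝ)
    (s : ℝ) : Prop where
  pos : 0 < s
  subset : Icc 0 s ⊆ I
  eq : (γ s).1 = t₀
  mem : ∀ r ∈ Ico 0 s, (γ r).1 ∈ Ioc t₀ t₁
  norm_le : ∀ r ∈ Ico 0 s, ‖deriv γ r‖ ≤ B
  fst_le : ∀ r ∈ Ico 0 s, (deriv γ r).1 ≤ -c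
  close : ∀ r ∈ Ico 0 s, ‖deriv γ r - nullField a t₁ v (γ r).1‖ ≤ e

/-- Either `P` holds throughout `[0, T)`, or there is a first parameter at which it fails. -/
theorem exists_first_exit {P : ℝ → Prop} {T : ℝ} (hT : 0 < T)
    (hP : IsClosed {r ∈ Icc 0 T | ¬ P r}) (h0 : P 0) :
    ∃ s ∈ Ioc 0 T, (∀ r ∈ Ico 0 s, P r) ∧ (s = T ∨ ¬ P s) := by
  rcases ({r ∈ Icc 0 T | ¬ P r}).eq_empty_or_nonempty with h | h
  · refine ⟨T, ⟨hT, le_rfl⟩, fun r hr => ?_, Or.inl rfl⟩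
    by_contra hc
    have : r ∈ {r ∈ Icc 0 T | ¬ P r} := ⟨Ico_subset_Icc_self hr, hc⟩
    exact eq_empty_iff_forall_notMem.1 h r this
  · obtain ⟨s, ⟨hs, hs'⟩, hmin⟩ :=
      (isCompact_Icc.of_isClosed_subset hP fun r hr => hr.1).exists_isLeast h
    refine ⟨s, ⟨lt_of_le_of_ne hs.1 ?_, hs.2⟩, fun r hr => ?_, Or.inr hs'⟩
    · rintro rfl
      exact hs' h0
    · by_contra hc
      exact absurd (hmin ⟨⟨hr.1, hr.2.le.trans hs.2⟩, hc⟩) (not_le.2 hr.2)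

/-- A lightlike geodesic of a metric close to the background reaches the surface `t = t₀`. The
constant `2 c` bounds from below the rate at which `t` decreases along the background rays, and `B - 1`
bounds their velocity. -/
theorem exists_reachesSurface {a : ℝ → ℝ} {t₀ t₁ m A A' δ B T c : ℝ}
    (hs : SlabBounds a t₀ t₁ m A A') {G : ST → Form} (hG : IsMetric G) (hδ : IsClose a t₀ G δ)
    (hB : A / m + A / m ^ 2 + 1 = B) (hc : m / A = 2 * c) (hT : (t₁ - t₀) / c + 1 = T)
    (hsmall : deviationConst m A A' B T * δ ≤ 1 / 2) (hsmall' : deviationConst m A A' B T * δ ≤ c)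
    {y v : Space} (hv : ‖v‖ = 1) (hy : G (t₁, y) = flrw a (t₁, y)) :
    ∃ (γ : ℝ → ST) (I : Set ℝ) (s : ℝ), IsGeodesicFrom G (t₁, y) (direction a t₁ v) γ I ∧
      s ≤ T ∧ ReachesSurface a t₀ t₁ v B c (deviationConst m A A' B T * δ) γ I s := by
  have hm := hs.m_pos
  have hA := hs.A_pos
  have hlt := hs.lt
  have hc0 : 0 < c := by
    have : 0 < m / A := by positivity
    linarith
  have hT0 : 0 < T := by
    have : 0 < (t₁ - t₀) / c := div_pos (by linarith) hc0
    linarith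
  have hB0 : 0 < B := by rw [← hB]; positivity
  set x : ST := (t₁, y)
  set θ := direction a t₁ v with hθdef
  have hθ : ‖θ‖ < B := by
    have := hs.norm_nullField_le hv hs.mem_t₁
    rw [hs.nullField_t₁] at this
    linarith
  -- Outside a neighbourhood of `K`, the spray is cut off. The bounds on `U` are not attained before
  -- the curve reaches `t = t₀`, so it can leave `U` only there.
  set K : Set (ST × ST) := (Icc t₀ (t₁ + 1) ×ˢ Metric.closedBall y (B * T + 1)) ×ˢ
    Metric.closedBall 0 B with hK
  set U : Set (ST × ST) := (Ioo t₀ (t₁ + 1) ×ˢ Metric.ball y (B * T + 1)) ×ˢ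
    Metric.ball 0 B with hU
  have hUK : U ⊆ K := prod_mono (prod_mono Ioo_subset_Icc_self Metric.ball_subset_closedBall)
    Metric.ball_subset_closedBall
  have hUo : IsOpen U := (isOpen_Ioo.prod Metric.isOpen_ball).prod Metric.isOpen_ball
  have hKc : IsCompact K := (isCompact_Icc.prod (isCompact_closedBall _ _)).prod
    (isCompact_closedBall _ _)
  have hKp : K ⊆ phaseSpace := fun z hz => hs.pos.trans_le hz.1.1.1
  obtain ⟨W, C, L, O, hWC, hWL, hO, hKO, hOp, hWO⟩ :=
    exists_lipschitz_bounded_eqOn isOpen_phaseSpace hG.contDiffOn_spray hKc hKp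
  obtain ⟨z, hz0, hz⟩ := exists_hasDerivAt_of_lipschitz_of_bounded hWC hWL (x, θ)
    (show 0 < T + 1 by linarith)
  have hzc : ContinuousOn z (Ioo (-(T + 1)) (T + 1)) := fun r hr =>
    (hz r hr).continuousAt.continuousWithinAt
  have hTsub : Icc 0 T ⊆ Ioo (-(T + 1)) (T + 1) := fun r hr =>
    ⟨by linarith [hr.1], by linarith [hr.2]⟩
  set P : Set ℝ := Ioo (-(T + 1)) (T + 1) ∩ z ⁻¹' O with hP
  have hPo : IsOpen P := hzc.isOpen_inter_preimage isOpen_Ioo hO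
  set I : Set ℝ := connectedComponentIn P 0 with hI
  have hz0U : z 0 ∈ U := by
    rw [hz0]
    exact ⟨⟨⟨hlt, by simp [x]⟩, Metric.mem_ball_self (by positivity)⟩, by simpa using hθ⟩
  have hseg : ∀ s ∈ Icc 0 T, (∀ r ∈ Icc 0 s, z r ∈ K) → Icc 0 s ⊆ I := by
    intro s hs' hr
    refine isPreconnected_Icc.subset_connectedComponentIn ⟨le_rfl, hs'.1⟩ fun r hr' =>
      ⟨hTsub ⟨hr'.1, hr'.2.trans hs'.2⟩, hKO (hr r hr')⟩
  have hIP : I ⊆ P := connectedComponentIn_subset P 0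
  have hIo : IsOpen I := hPo.connectedComponentIn
  have h0I : (0 : ℝ) ∈ I := mem_connectedComponentIn
    ⟨hTsub ⟨le_rfl, hT0.le⟩, hKO (hUK hz0U)⟩
  set γ : ℝ → ST := fun r => (z r).1 with hγdef
  obtain ⟨hgeo, hγ'⟩ := hG.isGeodesicOn_fst hIo (z := z) fun r hr =>
    ⟨hOp (hIP hr).2, by rw [← hWO (hIP hr).2]; exact hz r (hIP hr).1⟩
  have hγ : IsGeodesicFrom G x θ γ I :=
    ⟨hIo, isPreconnected_connectedComponentIn.ordConnected, h0I, hgeo,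
      by simp [hγdef, hz0], by rw [hγ' 0 h0I, hz0]⟩
  obtain ⟨s, hsT, hsU, hsend⟩ := exists_first_exit (P := fun r => z r ∈ U) hT0 (by
    have := (hzc.mono hTsub).preimage_isClosed_of_isClosed isClosed_Icc hUo.isClosed_compl
    exact this) hz0U
  have hsT' : Icc 0 s ⊆ Icc 0 T := Icc_subset_Icc_right hsT.2
  -- the estimates before the curve leaves `U`
  have hest : ∀ r ∈ Ico 0 s, r ∈ I ∧
      ‖(z r).2 - nullField a t₁ v (z r).1.1‖ ≤ deviationConst m A A' B T * δ := by
    intro r hr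
    have hrK : ∀ q ∈ Icc 0 r, z q ∈ U := fun q hq => hsU q ⟨hq.1, hq.2.trans_lt hr.2⟩
    have hrI := hseg r ⟨hr.1, hr.2.le.trans hsT.2⟩ fun q hq => hUK (hrK q hq)
    have hrI' : r ∈ I := hrI ⟨hr.1, le_rfl⟩
    refine ⟨hrI', ?_⟩
    rw [← hγ' r hrI']
    refine norm_velocity_sub_nullField_le hs hG hδ hv hy hγ hr.1 (hr.2.le.trans hsT.2) hrI
      (fun q hq => ?_) fun q hq => ?_
    · exact Ioo_subset_Ioc_self (hrK q hq).1.1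
    · rw [hγ' q (hrI hq)]
      simpa using (hUK (hrK q hq)).2
  have hp1 : ∀ r ∈ Ico 0 s, (z r).2.1 ≤ -c := by
    intro r hr
    have h1 := (abs_le.1 ((norm_fst_le _).trans (hest r hr).2)).2
    have h2 := hs.nullField_fst_le v (Ioo_subset_Icc_self (hsU r hr).1.1)
    rw [Prod.fst_sub] at h1
    linarith
  have hpn : ∀ r ∈ Ico 0 s, ‖(z r).2‖ ≤ B - 1 / 2 := by
    intro r hr
    have h1 := (hest r hr).2
    have h2 := hs.norm_nullField_le hv (Ioo_subset_Icc_self (hsU r hr).1.1)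
    have h3 := norm_le_norm_add_norm_sub' (z r).2 (nullField a t₁ v (z r).1.1)
    linarith
  have hzd : ∀ r ∈ Icc 0 s, HasDerivAt z (W (z r)) r := fun r hr => hz r (hTsub (hsT' hr))
  have hz1 : ∀ r ∈ Ico 0 s, HasDerivAt γ (z r).2 r := fun r hr => by
    rw [← hγ' r (hest r hr).1]
    exact (hgeo r (hest r hr).1).2.1.hasDerivAt
  have hγc : ContinuousOn γ (Icc 0 s) := fun r hr =>
    (continuous_fst.continuousAt.comp (hzd r hr).continuousAt).continuousWithinAt
  have hmono : ∀ r ∈ Icc 0 s, (γ r).1 + c * r ≤ t₁ := by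
    have hanti : AntitoneOn (fun r => (γ r).1 + c * r) (Icc 0 s) := by
      have hd : ∀ r ∈ Ico 0 s, HasDerivAt (fun r => (γ r).1 + c * r) ((z r).2.1 + c * 1) r :=
        fun r hr => ((hasFDerivAt_fst (p := γ r)).comp_hasDerivAt r (hz1 r hr)).add
          ((hasDerivAt_id r).const_mul c)
      refine antitoneOn_of_deriv_nonpos (convex_Icc _ _) ?_ ?_ ?_
      · exact (continuous_fst.comp_continuousOn hγc).add (by fun_prop)
      · rw [interior_Icc]
        exact fun r hr => (hd r (Ioo_subset_Ico_self hr)).differentiableAt.differentiableWithinAt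
      · rw [interior_Icc]
        intro r hr
        rw [(hd r (Ioo_subset_Ico_self hr)).deriv]
        linarith [hp1 r (Ioo_subset_Ico_self hr)]
    intro r hr
    have := hanti ⟨le_rfl, hsT.1.le⟩ hr hr.1
    simpa [hγdef, hz0, x] using this
  have hsmem : s ∈ Icc 0 s := ⟨hsT.1.le, le_rfl⟩
  have hev : ∀ᶠ r in 𝓝[<] s, r ∈ Ico 0 s := Ico_mem_nhdsLT hsT.1
  have hzs : Tendsto z (𝓝[<] s) (𝓝 (z s)) := (hzd s hsmem).continuousAt.mono_left nhdsWithin_le_nhds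
  have hdist : ‖γ s - γ 0‖ ≤ B * T := by
    have := (norm_image_sub_le_of_norm_deriv_right_le_segment (f' := fun r => (z r).2) (C := B) hγc
      (fun r hr => (hz1 r hr).hasDerivWithinAt) (fun r hr => by linarith [hpn r hr]) s hsmem)
    exact this.trans (by gcongr; linarith [hsT.2])
  have hspn : ‖(z s).2‖ ≤ B - 1 / 2 :=
    le_of_tendsto (continuous_norm.continuousAt.tendsto.comp
      (continuous_snd.continuousAt.tendsto.comp hzs)) (hev.mono fun r hr => hpn r hr)
  have hst0 : t₀ ≤ (γ s).1 :=
    ge_of_tendsto (continuous_fst.continuousAt.tendsto.comp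
      (continuous_fst.continuousAt.tendsto.comp hzs)) (hev.mono fun r hr => (hsU r hr).1.1.1.le)
  have hst1 := hmono s hsmem
  have hcs : 0 < c * s := mul_pos hc0 hsT.1
  have hy' : dist (γ s).2 y ≤ B * T := by
    have h1 : γ 0 = (t₁, y) := by simp [hγdef, hz0, x]
    rw [h1] at hdist
    rw [dist_eq_norm]
    exact (norm_snd_le (γ s - (t₁, y))).trans hdist
  -- `T` exceeds the time needed to descend from `t₁` to `t₀` at rate `c`
  have heq : (γ s).1 = t₀ := by
    rcases hsend with h | h
    · have : c * T = t₁ - t₀ + c := by rw [← hT]; field_simp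
      rw [h] at hst1 hst0
      linarith
    · by_contra hne
      refine h ⟨⟨⟨lt_of_le_of_ne hst0 (Ne.symm hne), ?_⟩, ?_⟩, ?_⟩
      · change (γ s).1 < t₁ + 1
        linarith
      · rw [Metric.mem_ball]
        change dist (γ s).2 y < _
        linarith
      · rw [mem_ball_zero_iff]
        linarith
  have hsK : ∀ r ∈ Icc 0 s, z r ∈ K := by
    intro r hr
    rcases hr.2.lt_or_eq with h | rfl
    · exact hUK (hsU r ⟨hr.1, h⟩)
    · refine ⟨⟨⟨hst0, ?_⟩, ?_⟩, ?_⟩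
      · change (γ r).1 ≤ t₁ + 1
        linarith
      · rw [Metric.mem_closedBall]
        change dist (γ r).2 y ≤ _
        linarith
      · rw [mem_closedBall_zero_iff]
        linarith
  refine ⟨γ, I, s, hγ, hsT.2, hsT.1, hseg s (Ioc_subset_Icc_self hsT) hsK, heq, fun r hr => ?_,
    fun r hr => ?_, fun r hr => ?_, fun r hr => ?_⟩
  · refine ⟨(hsU r hr).1.1.1, ?_⟩
    have : 0 ≤ c * r := mul_nonneg hc0.le hr.1
    linarith [hmono r (Ico_subset_Icc_self hr)]
  · rw [hγ' r (hest r hr).1]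
    linarith [hpn r hr]
  · rw [hγ' r (hest r hr).1]
    exact hp1 r hr
  · rw [hγ' r (hest r hr).1]
    exact (hest r hr).2

/-- The maximal geodesic of a metric close to the background reaches the surface `t = t₀`, and the
first hitting parameter exists. -/
theorem ReachesSurface.of_isGeodesicFrom {a : ℝ → ℝ} {t₀ t₁ B c e s : ℝ} {G : ST → Form}
    (hG : IsMetric G) {x θ : ST} {v : Space} {γ : ℝ → ST} {I : Set ℝ} (h : IsGeodesicFrom G x θ γ I)
    (hs : ReachesSurface a t₀ t₁ v B c e γ I s) :
    IsLeast (hits G t₀ x θ) s ∧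
      ReachesSurface a t₀ t₁ v B c e (geodesic G x θ) (geodesicDomain G x θ) s := by
  have heq := hG.geodesic_eqOn h
  have hder : ∀ r ∈ I, deriv (geodesic G x θ) r = deriv γ r := fun r hr =>
    EventuallyEq.deriv_eq (by filter_upwards [h.1.mem_nhds hr] with q hq using heq hq)
  have hId : I ⊆ geodesicDomain G x θ := fun r hr => ⟨γ, I, h, hr⟩
  have hsub := hs.subset
  have hsI : s ∈ I := hsub ⟨hs.pos.le, le_rfl⟩
  have hrI : ∀ r ∈ Ico 0 s, r ∈ I := fun r hr => hsub (Ico_subset_Icc_self hr)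
  refine ⟨⟨⟨hs.pos, hId hsI, ?_⟩, ?_⟩, hs.pos, hsub.trans hId, ?_, ?_, ?_, ?_, ?_⟩
  · change (geodesic G x θ s).1 = t₀
    rw [heq hsI, hs.eq]
  · rintro r ⟨hr0, -, hr⟩
    by_contra! hlt
    have h1 : (geodesic G x θ r).1 = t₀ := hr
    rw [heq (hrI r ⟨hr0.le, hlt⟩)] at h1
    exact (hs.mem r ⟨hr0.le, hlt⟩).1.ne' h1
  · rw [heq hsI, hs.eq]
  · exact fun r hr => by rw [heq (hrI r hr)]; exact hs.mem r hr
  · exact fun r hr => by rw [hder r (hrI r hr)]; exact hs.norm_le r hr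
  · exact fun r hr => by rw [hder r (hrI r hr)]; exact hs.fst_le r hr
  · exact fun r hr => by rw [hder r (hrI r hr), heq (hrI r hr)]; exact hs.close r hr

/-- Uniform control of the lightlike geodesics of metrics close to the background. -/
theorem exists_uniform_control {a : ℝ → ℝ} {t₀ t₁ m A A' : ℝ} (hs : SlabBounds a t₀ t₁ m A A') :
    ∃ B c C T η : ℝ, 0 < c ∧ 0 ≤ C ∧ 0 < η ∧ ∀ (G : ST → Form) (δ : ℝ), IsMetric G →
      IsClose a t₀ G δ → δ ≤ η → ∀ y v : Space, ‖v‖ = 1 → G (t₁, y) = flrw a (t₁, y) →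
      IsGeodesicFrom G (t₁, y) (direction a t₁ v) (geodesic G (t₁, y) (direction a t₁ v))
        (geodesicDomain G (t₁, y) (direction a t₁ v)) ∧
      IsLeast (hits G t₀ (t₁, y) (direction a t₁ v)) (hitTime G t₀ (t₁, y) (direction a t₁ v)) ∧
      hitTime G t₀ (t₁, y) (direction a t₁ v) ≤ T ∧
      ReachesSurface a t₀ t₁ v B c (C * δ) (geodesic G (t₁, y) (direction a t₁ v))
        (geodesicDomain G (t₁, y) (direction a t₁ v))
        (hitTime G t₀ (t₁, y) (direction a t₁ v)) := by
  have hm := hs.m_pos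
  have hA := hs.A_pos
  have hA' := hs.A'_nonneg
  set B := A / m + A / m ^ 2 + 1 with hB
  set c := m / A / 2 with hc
  have hc0 : 0 < c := by positivity
  set T := (t₁ - t₀) / c + 1 with hT
  have hT0 : 0 ≤ T := by
    have : 0 ≤ (t₁ - t₀) / c := div_nonneg (by linarith [hs.lt]) hc0.le
    linarith
  have hB0 : 0 ≤ B := by positivity
  set C := deviationConst m A A' B T with hC
  have hC0 : 0 ≤ C := by rw [hC, deviationConst]; positivity
  refine ⟨B, c, C, T, min (1 / 2) c / (C + 1), hc0, hC0, by positivity,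
    fun G δ hG hδ hδη y v hv hy => ?_⟩
  have hsm : C * δ ≤ min (1 / 2) c := by
    have h1 : C * δ ≤ C * (min (1 / 2) c / (C + 1)) := by gcongr
    have h2 : C * (min (1 / 2) c / (C + 1)) ≤ min (1 / 2) c := by
      rw [← mul_div_assoc, div_le_iff₀ (by positivity)]
      have : 0 ≤ min (1 / 2) c := by positivity
      nlinarith
    exact h1.trans h2
  obtain ⟨γ, I, s, hγ, hsT, hreach⟩ := exists_reachesSurface hs hG hδ hB.symm
    (show m / A = 2 * c by rw [hc]; ring) hT.symm (hsm.trans (min_le_left _ _))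
    (hsm.trans (min_le_right _ _)) hv hy
  obtain ⟨h1, h2⟩ := hreach.of_isGeodesicFrom hG hγ
  have h3 : hitTime G t₀ (t₁, y) (direction a t₁ v) = s := h1.csInf_eq
  rw [h3]
  exact ⟨hG.isGeodesicFrom_geodesic hγ, h1, hsT, h2⟩

open MeasureTheory

/-! ### Consequences of differentiability in `C_b²` -/

section BoundedFunctions

variable {E F : Type*} [NormedAddCommGroup E] [NormedSpace ℝ E]
  [NormedAddCommGroup F] [NormedSpace ℝ F]

theorem enorm_iteratedFDeriv_le_cbTwoNorm {S : Set E} (u : E → F) {x : E} (hx : x ∈ S) {k : ℕ}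
    (hk : k < 3) : ‖iteratedFDeriv ℝ k u x‖ₑ ≤ cbTwoNorm S u :=
  (le_iSup₂ (f := fun x (_ : x ∈ S) => ‖iteratedFDeriv ℝ k u x‖ₑ) x hx).trans
    (Finset.single_le_sum (f := fun k => ⨆ x ∈ S, ‖iteratedFDeriv ℝ k u x‖ₑ)
      (fun _ _ => zero_le) (Finset.mem_range.2 hk))

theorem norm_le_of_cbTwoNorm_le {S : Set E} {u : E → F} {b : ℝ} (hb : 0 ≤ b)
    (hu : cbTwoNorm S u ≤ ENNReal.ofReal b) {x : E} (hx : x ∈ S) :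
    ‖u x‖ ≤ b ∧ ‖fderiv ℝ u x‖ ≤ b := by
  have key : ∀ k < 3, ‖iteratedFDeriv ℝ k u x‖ ≤ b := by
    intro k hk
    have := (enorm_iteratedFDeriv_le_cbTwoNorm u hx hk).trans hu
    rwa [← ofReal_norm, ENNReal.ofReal_le_ofReal_iff hb] at this
  refine ⟨?_, ?_⟩
  · simpa using key 0 (by norm_num)
  · simpa [norm_iteratedFDeriv_one] using key 1 (by norm_num)

/-- If `ε ↦ h ε` is differentiable into `C_b²` and vanishes at `ε = 0`, then the difference quotients
at `0` and their first derivatives converge uniformly. -/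
theorem CbTwoDifferentiableOn.exists_tendsto_uniformly {S : Set E} (hS : IsOpen S)
    {h : ℝ → E → F} (hh : CbTwoDifferentiableOn (Icc 0 1) S h) (h0 : ∀ x ∈ S, h 0 x = 0) :
    ∃ (u : E → F) (M : ℝ), ContDiffOn ℝ 2 u S ∧ 0 ≤ M ∧
      (∀ x ∈ S, ‖u x‖ ≤ M ∧ ‖fderiv ℝ u x‖ ≤ M) ∧
      ∀ η > 0, ∀ᶠ δ in 𝓝[Icc 0 1 \ {0}] (0 : ℝ), ∀ x ∈ S,
        ‖δ⁻¹ • h δ x - u x‖ ≤ η ∧ ‖δ⁻¹ • fderiv ℝ (h δ) x - fderiv ℝ u x‖ ≤ η := by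
  obtain ⟨hmem, hd⟩ := hh
  obtain ⟨u, ⟨huC, hub⟩, hlim⟩ := hd 0 ⟨le_rfl, zero_le_one⟩
  refine ⟨u, (cbTwoNorm S u).toReal, huC, ENNReal.toReal_nonneg, fun x hx =>
    norm_le_of_cbTwoNorm_le ENNReal.toReal_nonneg (ENNReal.ofReal_toReal hub.ne).ge hx,
    fun η hη => ?_⟩
  have hev := hlim.eventually (eventually_le_nhds (ENNReal.ofReal_pos.2 hη))
  filter_upwards [hev, self_mem_nhdsWithin] with δ hδ hδm x hx
  obtain ⟨h1, h2⟩ := norm_le_of_cbTwoNorm_le hη.le hδ hx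
  have hSx := hS.mem_nhds hx
  have hdh : DifferentiableAt ℝ (h δ) x :=
    ((hmem δ hδm.1).1.contDiffAt hSx).differentiableAt (by norm_num)
  have hdu : DifferentiableAt ℝ u x := (huC.contDiffAt hSx).differentiableAt (by norm_num)
  have heq : (fun x => (δ - 0)⁻¹ • (h δ x - h 0 x) - u x) =ᶠ[𝓝 x] fun x => δ⁻¹ • h δ x - u x := by
    filter_upwards [hSx] with z hz
    rw [h0 z hz, sub_zero, sub_zero]
  have h3 : HasFDerivAt (fun x => δ⁻¹ • h δ x - u x) (δ⁻¹ • fderiv ℝ (h δ) x - fderiv ℝ u x) x :=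
    (hdh.hasFDerivAt.const_smul δ⁻¹).sub hdu.hasFDerivAt
  rw [heq.fderiv_eq, h3.fderiv] at h2
  rw [h0 x hx, sub_zero, sub_zero] at h1
  exact ⟨h1, h2⟩

end BoundedFunctions

theorem norm_le_of_norm_inv_smul_sub_le {F : Type*} [NormedAddCommGroup F] [NormedSpace ℝ F]
    {δ M : ℝ} (hδ : 0 < δ) {x u : F} (hu : ‖u‖ ≤ M) (h : ‖δ⁻¹ • x - u‖ ≤ 1) :
    ‖δ⁻¹ • x‖ ≤ M + 1 ∧ ‖x‖ ≤ (M + 1) * δ := by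
  have h1 : ‖δ⁻¹ • x‖ ≤ M + 1 := by linarith [norm_le_norm_add_norm_sub' (δ⁻¹ • x) u]
  refine ⟨h1, ?_⟩
  rw [norm_smul, norm_inv, Real.norm_eq_abs, abs_of_pos hδ, ← div_eq_inv_mul, div_le_iff₀ hδ] at h1
  exact h1

/-! ### The limit of the rays -/

/-- Since `t` decreases at a rate of at least `c`, it is at least `c (s - r)` above the surface at
parameter `r`. -/
theorem ReachesSurface.fst_add_le {a : ℝ → ℝ} {t₀ t₁ B c e s : ℝ} {v : Space} {γ : ℝ → ST}
    {I : Set ℝ} (h : ReachesSurface a t₀ t₁ v B c e γ I s) (hγ : ∀ r ∈ I, DifferentiableAt ℝ γ r)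
    {r : ℝ} (hr : r ∈ Icc 0 s) : t₀ + c * (s - r) ≤ (γ r).1 := by
  have hd : ∀ q ∈ Icc 0 s, HasDerivAt (fun q => (γ q).1 + c * q) ((deriv γ q).1 + c * 1) q :=
    fun q hq => ((hasFDerivAt_fst (p := γ q)).comp_hasDerivAt q (hγ q (h.subset hq)).hasDerivAt).add
      ((hasDerivAt_id q).const_mul c)
  have hanti : AntitoneOn (fun q => (γ q).1 + c * q) (Icc 0 s) := by
    refine antitoneOn_of_deriv_nonpos (convex_Icc _ _) (fun q hq =>
      (hd q hq).continuousAt.continuousWithinAt) ?_ ?_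
    · rw [interior_Icc]
      exact fun q hq => (hd q (Ioo_subset_Icc_self hq)).differentiableAt.differentiableWithinAt
    · rw [interior_Icc]
      intro q hq
      rw [(hd q (Ioo_subset_Icc_self hq)).deriv]
      linarith [h.fst_le q (Ioo_subset_Ico_self hq)]
  have := hanti hr ⟨h.pos.le, le_rfl⟩ hr.2
  simp only [h.eq] at this
  linarith

/-- Two rays with the same initial point stay close, and reach the surface at close parameters. -/
theorem ReachesSurface.dist_le {a : ℝ → ℝ} {t₀ t₁ B c e s e' s' T : ℝ} {v : Space}
    {γ γ' : ℝ → ST} {I I' : Set ℝ} {K : NNReal} (he : 0 ≤ e) (he' : 0 ≤ e')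
    (hK : LipschitzOnWith K (nullField a t₁ v) (Icc t₀ (t₁ + 1)))
    (h : ReachesSurface a t₀ t₁ v B c e γ I s) (hγ : ∀ r ∈ I, DifferentiableAt ℝ γ r)
    (h' : ReachesSurface a t₀ t₁ v B c e' γ' I' s') (hγ' : ∀ r ∈ I', DifferentiableAt ℝ γ' r)
    (h0 : γ 0 = γ' 0) (hT : min s s' ≤ T) :
    (∀ r ∈ Icc 0 (min s s'), dist (γ r) (γ' r) ≤ gronwallBound 0 K (e + e') T) ∧
      c * |s - s'| ≤ gronwallBound 0 K (e + e') T := by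
  have hI : ∀ r ∈ Icc 0 (min s s'), r ∈ I := fun r hr =>
    h.subset ⟨hr.1, hr.2.trans (min_le_left _ _)⟩
  have hI' : ∀ r ∈ Icc 0 (min s s'), r ∈ I' := fun r hr =>
    h'.subset ⟨hr.1, hr.2.trans (min_le_right _ _)⟩
  have hm : ∀ r ∈ Ico 0 (min s s'), r ∈ Ico 0 s := fun r hr =>
    ⟨hr.1, hr.2.trans_le (min_le_left _ _)⟩
  have hm' : ∀ r ∈ Ico 0 (min s s'), r ∈ Ico 0 s' := fun r hr =>
    ⟨hr.1, hr.2.trans_le (min_le_right _ _)⟩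
  have hslab : ∀ t ∈ Ioc t₀ t₁, t ∈ Icc t₀ (t₁ + 1) := fun t ht => ⟨ht.1.le, by linarith [ht.2]⟩
  have hLip : LipschitzOnWith K (fun x : ST => nullField a t₁ v x.1)
      {x | x.1 ∈ Icc t₀ (t₁ + 1)} :=
    LipschitzOnWith.of_dist_le_mul fun x hx z hz =>
      (hK.dist_le_mul _ hx _ hz).trans (by gcongr; exact le_max_left _ _)
  have hdist : ∀ r ∈ Icc 0 (min s s'), dist (γ r) (γ' r) ≤ gronwallBound 0 K (e + e') T := by
    intro r hr
    have h1 := dist_le_of_approx_trajectories_ODE_of_mem (δ := 0) (εf := e) (εg := e') (K := K)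
      (v := fun _ x => nullField a t₁ v x.1) (s := fun _ => {x | x.1 ∈ Icc t₀ (t₁ + 1)})
      (a := 0) (b := min s s') (f := γ) (g := γ') (f' := deriv γ) (g' := deriv γ')
      (fun _ _ => hLip)
      (fun q hq => (hγ q (hI q hq)).continuousAt.continuousWithinAt)
      (fun q hq => (hγ q (hI q (Ico_subset_Icc_self hq))).hasDerivAt.hasDerivWithinAt)
      (fun q hq => by rw [dist_eq_norm]; exact h.close q (hm q hq))
      (fun q hq => hslab _ (h.mem q (hm q hq)))
      (fun q hq => (hγ' q (hI' q hq)).continuousAt.continuousWithinAt)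
      (fun q hq => (hγ' q (hI' q (Ico_subset_Icc_self hq))).hasDerivAt.hasDerivWithinAt)
      (fun q hq => by rw [dist_eq_norm]; exact h'.close q (hm' q hq))
      (fun q hq => hslab _ (h'.mem q (hm' q hq))) (by rw [h0, dist_self]) r hr
    refine h1.trans (gronwallBound_mono le_rfl (by positivity) K.2 ?_)
    linarith [hr.2]
  refine ⟨hdist, ?_⟩
  have hd := hdist (min s s') ⟨le_min h.pos.le h'.pos.le, le_rfl⟩
  have hfst : ∀ x z : ST, |x.1 - z.1| ≤ dist x z := fun x z => by
    rw [dist_eq_norm]; exact norm_fst_le (x - z)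
  rcases le_total s s' with hle | hle
  · rw [min_eq_left hle] at hd
    have h1 := h'.fst_add_le hγ' (r := s) ⟨h.pos.le, hle⟩
    have h2 := (abs_le.1 ((hfst _ _).trans hd)).1
    rw [h.eq] at h2
    rw [abs_of_nonpos (by linarith)]
    linarith
  · rw [min_eq_right hle] at hd
    have h1 := h.fst_add_le hγ (r := s') ⟨h'.pos.le, hle⟩
    have h2 := (abs_le.1 ((hfst _ _).trans hd)).2
    rw [h'.eq] at h2
    rw [abs_of_nonneg (by linarith)]
    linarith

theorem contDiffOn_nullField {a : ℝ → ℝ} (ha : ContDiffOn ℝ ∞ a (Ioi 0))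
    (ha_pos : ∀ t, 0 < t → 0 < a t) (t₁ : ℝ) (v : Space) :
    ContDiffOn ℝ 1 (nullField a t₁ v) (Ioi 0) := by
  have h1 : ContDiffOn ℝ 1 a (Ioi 0) := ha.of_le (by exact_mod_cast le_top)
  exact (contDiffOn_const.div h1 fun t ht => (ha_pos t ht).ne').neg.prodMk
    ((contDiffOn_const.div (h1.pow 2) fun t ht =>
      pow_ne_zero 2 (ha_pos t ht).ne').smul contDiffOn_const).neg

/-! ### The energy balance of a ray -/

/-- The density `(a² 𝓛_{a ∂_t} (a⁻² T))(γ̇, γ̇)` along the curve `γ`. -/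
def rayDensity (a : ℝ → ℝ) (T : ST → Form) (γ : ℝ → ST) (r : ℝ) : ℝ :=
  conformalQuad a (γ r).1 (T (γ r)) (fderiv ℝ T (γ r)) (deriv γ r)

theorem continuousOn_rayDensity {a : ℝ → ℝ} (ha : ContDiffOn ℝ ∞ a (Ioi 0)) {T : ST → Form}
    {Ω : Set ST} (hΩ : IsOpen Ω) (hT : ContDiffOn ℝ 2 T Ω) {γ : ℝ → ST} {S : Set ℝ}
    (hγ : ContinuousOn γ S) (hγ' : ContinuousOn (deriv γ) S) (hmaps : MapsTo γ S Ω)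
    (hpos : ∀ r ∈ S, 0 < (γ r).1) : ContinuousOn (rayDensity a T γ) S := by
  have h1 : ContinuousOn (fun r => a (γ r).1) S :=
    ha.continuousOn.comp (continuous_fst.comp_continuousOn hγ) hpos
  have h2 : ContinuousOn (fun r => deriv a (γ r).1) S :=
    (ha.continuousOn_deriv_of_isOpen isOpen_Ioi (by simp)).comp
      (continuous_fst.comp_continuousOn hγ) hpos
  have h3 : ContinuousOn (fun r => T (γ r)) S := hT.continuousOn.comp hγ hmaps
  have h4 : ContinuousOn (fun r => fderiv ℝ T (γ r)) S :=
    (hT.continuousOn_fderiv_of_isOpen hΩ (by norm_num)).comp hγ hmaps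
  have h5 : ContinuousOn (fun r => (deriv γ r).1) S := continuous_fst.comp_continuousOn hγ'
  unfold rayDensity conformalQuad
  exact ((h1.mul (((h4.clm_apply continuousOn_const).clm_apply hγ').clm_apply hγ')).add
    ((h2.mul h5).mul (((h3.clm_apply continuousOn_const).clm_apply hγ').add
      ((h3.clm_apply hγ').clm_apply continuousOn_const)))).sub
    ((continuousOn_const.mul h2).mul ((h3.clm_apply hγ').clm_apply hγ'))

/-- The redshift is the integral of the density of the perturbation along the ray, up to the redshift
of the background. -/
theorem redshift_eq {a : ℝ → ℝ} (ha : ContDiffOn ℝ ∞ a (Ioi 0)) (ha_pos : ∀ t, 0 < t → 0 < a t)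
    {t₀ t₁ B c e : ℝ} (ht₀ : 0 < t₀) (ht₁ : t₀ < t₁) {G : ST → Form} (hG : IsMetric G)
    (hF : IsMetric (flrw a)) {y v : Space} (hv : ‖v‖ = 1) (hy : G (t₁, y) = flrw a (t₁, y))
    (hgeo : IsGeodesicFrom G (t₁, y) (direction a t₁ v) (geodesic G (t₁, y) (direction a t₁ v))
      (geodesicDomain G (t₁, y) (direction a t₁ v)))
    (hreach : ReachesSurface a t₀ t₁ v B c e (geodesic G (t₁, y) (direction a t₁ v))
      (geodesicDomain G (t₁, y) (direction a t₁ v))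
      (hitTime G t₀ (t₁, y) (direction a t₁ v))) :
    ContinuousOn (rayDensity a (fun x => G x - flrw a x) (geodesic G (t₁, y) (direction a t₁ v)))
        (Icc 0 (hitTime G t₀ (t₁, y) (direction a t₁ v))) ∧
      redshift a t₀ t₁ G y v =
        (a t₁ + (∫ r in Ioo 0 (hitTime G t₀ (t₁, y) (direction a t₁ v)),
          rayDensity a (fun x => G x - flrw a x) (geodesic G (t₁, y) (direction a t₁ v)) r) / 2) /
          a t₀ - 1 := by
  unfold redshift velocity
  set x : ST := (t₁, y)
  set θ := direction a t₁ v
  set γ := geodesic G x θ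
  set s := hitTime G t₀ x θ
  have ha0 := ha_pos t₀ ht₀
  have ha1 := ha_pos t₁ (ht₀.trans ht₁)
  have hsub := hreach.subset
  have hg := hgeo.2.2.2.1
  have hpos : ∀ r ∈ Icc 0 s, 0 < (γ r).1 := fun r hr => (hg r (hsub hr)).1
  have hcont : ContinuousOn (rayDensity a (fun x => G x - flrw a x) γ) (Icc 0 s) :=
    continuousOn_rayDensity ha isOpen_spacetime (hG.contDiffOn.sub hF.contDiffOn)
      (fun r hr => (hg r (hsub hr)).2.1.continuousAt.continuousWithinAt)
      (fun r hr => (hg r (hsub hr)).2.2.1.continuousAt.continuousWithinAt)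
      (fun r hr => (hg r (hsub hr)).1) hpos
  refine ⟨hcont, ?_⟩
  have hnull : ∀ r ∈ Icc 0 s, G (γ r) (deriv γ r) (deriv γ r) = 0 := fun r hr =>
    hgeo.norm_sq_eq_zero hG (by rw [hy]; exact flrw_direction ha1.ne' hv y) (hsub hr)
  have hFTC := intervalIntegral.integral_eq_sub_of_hasDerivAt (a := 0) (b := s)
    (f := fun r => G (γ r) (deriv γ r) (a (γ r).1 • dt))
    (f' := fun r => rayDensity a (fun x => G x - flrw a x) γ r / 2)
    (by
      rw [uIcc_of_le hreach.pos.le]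
      intro r hr
      exact hg.hasDerivAt_energy hG (hsub hr)
        ((ha.contDiffAt (Ioi_mem_nhds (hpos r hr))).differentiableAt (by simp)) (hnull r hr))
    ((by rw [uIcc_of_le hreach.pos.le]; exact hcont.div_const 2 : ContinuousOn _ (uIcc 0 s))
      |>.intervalIntegrable)
  have hE0 : G (γ 0) (deriv γ 0) (a (γ 0).1 • dt) = a t₁ := by
    rw [hgeo.2.2.2.2.1, hgeo.2.2.2.2.2, hy, map_smul, flrw_apply]
    have h6 : (dt : ST).1 = 1 := rfl
    have h7 : (dt : ST).2 = 0 := rfl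
    have h8 : θ.1 = -1 := rfl
    simp [h6, h7, h8, x]
  rw [hE0, hreach.eq, map_smul, smul_eq_mul, intervalIntegral.integral_div,
    intervalIntegral.integral_of_le hreach.pos.le, integral_Ioc_eq_integral_Ioo] at hFTC
  rw [hFTC]
  field_simp
  ring

/-! ### Rays of the background metric -/

/-- By conservation of energy, `t` decreases along the whole maximal ray of the background. -/
theorem fst_deriv_flrw_neg {a : ℝ → ℝ} (ha : ∀ t, 0 < t → DifferentiableAt ℝ a t)
    (ha_pos : ∀ t, 0 < t → 0 < a t) (hF : IsMetric (flrw a)) {t₁ : ℝ} (ht₁ : 0 < t₁) {y v : Space}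
    (hv : ‖v‖ = 1) {γ : ℝ → ST} {I : Set ℝ}
    (hγ : IsGeodesicFrom (flrw a) (t₁, y) (direction a t₁ v) γ I) {r : ℝ} (hr : r ∈ I) :
    (deriv γ r).1 < 0 := by
  have hnull : ∀ q ∈ I, flrw a (γ q) (deriv γ q) (deriv γ q) = 0 := fun q hq =>
    hγ.norm_sq_eq_zero hF (flrw_direction (ha_pos t₁ ht₁).ne' hv y) hq
  have hd : ∀ q ∈ I, HasDerivAt
      (fun s => flrw a (γ s) (deriv γ s) (a (γ s).1 • dt)) 0 q := fun q hq => by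
    refine (hγ.2.2.2.1.hasDerivAt_energy hF hq (ha _ (hγ.2.2.2.1 q hq).1)
      (hnull q hq)).congr_deriv ?_
    simp [conformalQuad]
  have hconst := hγ.1.is_const_of_deriv_eq_zero hγ.2.1.isPreconnected
    (fun q hq => (hd q hq).differentiableAt.differentiableWithinAt) (fun q hq => (hd q hq).deriv)
    hr hγ.2.2.1
  rw [hγ.2.2.2.2.1, hγ.2.2.2.2.2, map_smul, map_smul, flrw_apply, flrw_apply] at hconst
  have h6 : (dt : ST).1 = 1 := rfl
  have h7 : (dt : ST).2 = 0 := rfl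
  have h8 : (direction a t₁ v).1 = -1 := rfl
  simp only [h6, h7, h8, inner_zero_right, smul_eq_mul, mul_zero, add_zero, mul_one,
    neg_neg] at hconst
  have h1 := ha_pos _ (hγ.2.2.2.1 r hr).1
  have h2 := ha_pos t₁ ht₁
  by_contra! h3
  nlinarith [mul_nonneg h1.le h3]

theorem strictAntiOn_fst_flrw {a : ℝ → ℝ} (ha : ∀ t, 0 < t → DifferentiableAt ℝ a t)
    (ha_pos : ∀ t, 0 < t → 0 < a t) (hF : IsMetric (flrw a)) {t₁ : ℝ} (ht₁ : 0 < t₁) {y v : Space}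
    (hv : ‖v‖ = 1) {γ : ℝ → ST} {I : Set ℝ}
    (hγ : IsGeodesicFrom (flrw a) (t₁, y) (direction a t₁ v) γ I) :
    StrictAntiOn (fun r => (γ r).1) I := by
  have hd : ∀ r ∈ I, HasDerivAt (fun r => (γ r).1) (deriv γ r).1 r := fun r hr =>
    (hasFDerivAt_fst (p := γ r)).comp_hasDerivAt r (hγ.2.2.2.1 r hr).2.1.hasDerivAt
  refine strictAntiOn_of_deriv_neg hγ.2.1.convex
    (fun r hr => (hd r hr).continuousAt.continuousWithinAt) fun r hr => ?_
  rw [(hd r (interior_subset hr)).deriv]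
  exact fst_deriv_flrw_neg ha ha_pos hF ht₁ hv hγ (interior_subset hr)

/-! ### The tensor `∂_ε g_ε`, cut off to the slab -/

theorem cutoffDeriv_eventuallyEq_zero {t₀ t₁ : ℝ} (g : ℝ → ST → Form) {x : ST}
    (hx : x.1 ∉ Icc t₀ t₁) : cutoffDeriv t₀ t₁ g =ᶠ[𝓝 x] 0 := by
  have hopen : IsOpen {z : ST | z.1 ∉ Icc t₀ t₁} :=
    (isClosed_Icc.preimage continuous_fst).isOpen_compl
  filter_upwards [hopen.mem_nhds hx] with z hz
  have hz' : z ∉ {z : ST | z.1 ∈ Ioo t₀ t₁} := fun h => hz (Ioo_subset_Icc_self h)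
  exact indicator_of_notMem hz' _

/-- On `t₀ < t < t₁` the tensor `cutoffDeriv` is the derivative `u` of the family in `C_b²`. -/
theorem cutoffDeriv_eventuallyEq {t₀ t₁ : ℝ} {g : ℝ → ST → Form} {u : ST → Form}
    (hu : ∀ z ∈ future t₀, derivWithin (fun ε => g ε z) (Icc 0 1) 0 = u z) {x : ST}
    (hx : x.1 ∈ Ioo t₀ t₁) : cutoffDeriv t₀ t₁ g =ᶠ[𝓝 x] u := by
  have hopen : IsOpen {z : ST | z.1 ∈ Ioo t₀ t₁} := isOpen_Ioo.preimage continuous_fst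
  filter_upwards [hopen.mem_nhds hx] with z hz
  have hz' : z ∈ {z : ST | z.1 ∈ Ioo t₀ t₁} := hz
  rw [cutoffDeriv, indicator_of_mem hz', hu z hz.1]

theorem conformalLie_eq_zero {a : ℝ → ℝ} {T : ST → Form} {x : ST} (hT : T =ᶠ[𝓝 x] 0) :
    conformalLie a T x = 0 := by
  have h : scaleDown a T =ᶠ[𝓝 x] 0 := by
    filter_upwards [hT] with z hz
    simp [scaleDown, hz]
  have h1 : scaleDown a T x = 0 := h.eq_of_nhds
  have h2 : fderiv ℝ (scaleDown a T) x = 0 := by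
    rw [h.fderiv_eq]
    exact fderiv_const_apply _
  rw [conformalLie, lieDeriv, h1, h2]
  refine ContinuousLinearMap.ext fun p => ContinuousLinearMap.ext fun q => ?_
  simp

theorem conformalLie_apply_of_eventuallyEq {a : ℝ → ℝ} {T u : ST → Form} {x : ST}
    (ha : DifferentiableAt ℝ a x.1) (ha0 : a x.1 ≠ 0) (hu : DifferentiableAt ℝ u x)
    (hT : T =ᶠ[𝓝 x] u) (p : ST) :
    conformalLie a T x p p = conformalQuad a x.1 (u x) (fderiv ℝ u x) p := by
  rw [conformalLie_apply ha ha0 (hu.congr_of_eventuallyEq hT), hT.eq_of_nhds, hT.fderiv_eq]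

/-- The derivative in `C_b²` is a pointwise derivative. -/
theorem derivWithin_eq_of_tendsto_uniformly {t₀ : ℝ} {g : ℝ → ST → Form} {f u : ST → Form}
    (h0 : ∀ z ∈ future t₀, g 0 z = f z)
    (hlim : ∀ η > 0, ∀ᶠ δ in 𝓝[Icc 0 1 \ {0}] (0 : ℝ), ∀ z ∈ future t₀,
      ‖δ⁻¹ • (g δ z - f z) - u z‖ ≤ η) :
    ∀ z ∈ future t₀, derivWithin (fun ε => g ε z) (Icc 0 1) 0 = u z := by
  intro z hz
  refine HasDerivWithinAt.derivWithin ?_ (uniqueDiffOn_Icc_zero_one 0 ⟨le_rfl, zero_le_one⟩)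
  rw [hasDerivWithinAt_iff_tendsto_slope, Metric.tendsto_nhds]
  intro η hη
  filter_upwards [hlim (η / 2) (by positivity)] with δ hδ
  rw [slope_def_module, h0 z hz, sub_zero, dist_eq_norm]
  linarith [hδ z hz]

/-- The integrand of the light ray transform vanishes off the segment between the two surfaces, where
it is the density of the tensor `u = ∂_ε g_ε`. -/
theorem lightRay_eq {a : ℝ → ℝ} (ha : ContDiffOn ℝ ∞ a (Ioi 0)) (ha_pos : ∀ t, 0 < t → 0 < a t)
    (hF : IsMetric (flrw a)) {t₀ t₁ : ℝ} (ht₀ : 0 < t₀) (ht₁ : t₀ < t₁) {g : ℝ → ST → Form}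
    {u : ST → Form} (huC : ContDiffOn ℝ 2 u (future t₀))
    (hu : ∀ z ∈ future t₀, derivWithin (fun ε => g ε z) (Icc 0 1) 0 = u z)
    {y v : Space} (hv : ‖v‖ = 1)
    (hγ : IsGeodesicFrom (flrw a) (t₁, y) (direction a t₁ v)
      (geodesic (flrw a) (t₁, y) (direction a t₁ v))
      (geodesicDomain (flrw a) (t₁, y) (direction a t₁ v)))
    {s : ℝ} (hs : s ∈ geodesicDomain (flrw a) (t₁, y) (direction a t₁ v))
    (hst : (geodesic (flrw a) (t₁, y) (direction a t₁ v) s).1 = t₀)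
    (hint : IntegrableOn (rayDensity a u (geodesic (flrw a) (t₁, y) (direction a t₁ v)))
      (Ioo 0 s)) :
    IntegrableOn (rayIntegrand (flrw a) (conformalLie a (cutoffDeriv t₀ t₁ g)) (t₁, y)
        (direction a t₁ v)) (geodesicDomain (flrw a) (t₁, y) (direction a t₁ v)) ∧
      lightRay a t₁ (conformalLie a (cutoffDeriv t₀ t₁ g)) y v =
        ∫ r in Ioo 0 s, rayDensity a u (geodesic (flrw a) (t₁, y) (direction a t₁ v)) r := by
  have had : ∀ t, 0 < t → DifferentiableAt ℝ a t := fun t ht =>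
    (ha.contDiffAt (Ioi_mem_nhds ht)).differentiableAt (by simp)
  set x : ST := (t₁, y)
  set θ := direction a t₁ v
  set γ := geodesic (flrw a) x θ with hγdef
  set D := geodesicDomain (flrw a) x θ with hD
  have hanti := strictAntiOn_fst_flrw had ha_pos hF (ht₀.trans ht₁) hv hγ
  have h0D : (0 : ℝ) ∈ D := hγ.2.2.1
  have hγ0 : (γ 0).1 = t₁ := by rw [hγ.2.2.2.2.1]
  have hDm : MeasurableSet D := hγ.1.measurableSet
  have hsub : Ioo 0 s ⊆ D := Ioo_subset_Icc_self.trans (hγ.2.1.out h0D hs)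
  have hind : ∀ r ∈ D, r ≠ 0 → r ≠ s →
      rayIntegrand (flrw a) (conformalLie a (cutoffDeriv t₀ t₁ g)) x θ r =
        (Ioo 0 s).indicator (rayDensity a u γ) r := by
    intro r hr hr0 hrs
    unfold rayIntegrand velocity
    by_cases hmem : r ∈ Ioo 0 s
    · have h1 : (γ r).1 ∈ Ioo t₀ t₁ := by
        have h2 := hanti h0D hr hmem.1
        have h3 := hanti hr hs hmem.2
        simp only [hγ0, hst] at h2 h3
        exact ⟨h3, h2⟩
      have hpos := ht₀.trans h1.1
      rw [indicator_of_mem hmem, conformalLie_apply_of_eventuallyEq (had _ hpos)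
        (ha_pos _ hpos).ne' ((huC.contDiffAt ((isOpen_future t₀).mem_nhds h1.1)).differentiableAt
          (by norm_num)) (cutoffDeriv_eventuallyEq hu h1)]
      rfl
    · rw [indicator_of_notMem hmem, conformalLie_eq_zero (cutoffDeriv_eventuallyEq_zero g ?_)]
      · rfl
      · rintro ⟨h1, h2⟩
        rcases lt_or_gt_of_ne hr0 with h | h
        · have h3 := hanti hr h0D h
          simp only [hγ0] at h3
          exact absurd h2 (not_le.2 h3)
        · have h4 : s < r := lt_of_le_of_ne (not_lt.1 fun h5 => hmem ⟨h, h5⟩) (Ne.symm hrs)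
          have h3 := hanti hs hr h4
          simp only [hst] at h3
          exact absurd h1 (not_le.2 h3)
  -- at the parameters `0` and `s` the tensor need not be differentiable, and the Lie derivative is junk
  have hae : rayIntegrand (flrw a) (conformalLie a (cutoffDeriv t₀ t₁ g)) x θ
      =ᵐ[volume.restrict D] (Ioo 0 s).indicator (rayDensity a u γ) := by
    rw [EventuallyEq, ae_restrict_iff' hDm]
    filter_upwards [Measure.ae_ne volume (0 : ℝ), Measure.ae_ne volume s] with r h0 h1 hr
    exact hind r hr h0 h1
  refine ⟨?_, ?_⟩
  · refine Integrable.congr ?_ hae.symm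
    exact ((integrable_indicator_iff measurableSet_Ioo).2 hint).integrableOn
  · rw [lightRay, rayTransform, integral_congr_ae hae, setIntegral_indicator measurableSet_Ioo,
      inter_eq_right.2 hsub]

/-! ### The derivative of the integral along the rays -/

theorem tendsto_clm_apply {ι E F : Type*} [NormedAddCommGroup E] [NormedSpace ℝ E]
    [NormedAddCommGroup F] [NormedSpace ℝ F] {l : Filter ι} {L : ι → E →L[ℝ] F} {L₀ : E →L[ℝ] F}
    {p : ι → E} {p₀ : E} (hL : Tendsto L l (𝓝 L₀)) (hp : Tendsto p l (𝓝 p₀)) :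
    Tendsto (fun i => L i (p i)) l (𝓝 (L₀ p₀)) :=
  (isBoundedBilinearMap_apply.continuous.tendsto (L₀, p₀)).comp (hL.prodMk_nhds hp)

theorem tendsto_conformalQuad {ι : Type*} {l : Filter ι} {a : ℝ → ℝ} {t : ι → ℝ} {t' : ℝ}
    {B : ι → Form} {B₀ : Form} {B' : ι → ST →L[ℝ] Form} {B₀' : ST →L[ℝ] Form} {p : ι → ST} {p' : ST}
    (ha : ContinuousAt a t') (ha' : ContinuousAt (deriv a) t') (ht : Tendsto t l (𝓝 t'))
    (hB : Tendsto B l (𝓝 B₀)) (hB' : Tendsto B' l (𝓝 B₀')) (hp : Tendsto p l (𝓝 p')) :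
    Tendsto (fun i => conformalQuad a (t i) (B i) (B' i) (p i)) l
      (𝓝 (conformalQuad a t' B₀ B₀' p')) := by
  have h1 := ha.tendsto.comp ht
  have h2 := ha'.tendsto.comp ht
  have h3 : Tendsto (fun i => (p i).1) l (𝓝 p'.1) := (continuous_fst.tendsto p').comp hp
  have hdt : Tendsto (fun _ : ι => dt) l (𝓝 dt) := tendsto_const_nhds
  unfold conformalQuad
  have h4 := tendsto_clm_apply (tendsto_clm_apply (tendsto_clm_apply hB' hdt) hp) hp
  have h5 := tendsto_clm_apply (tendsto_clm_apply hB hdt) hp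
  have h6 := tendsto_clm_apply (tendsto_clm_apply hB hp) hdt
  have h7 := tendsto_clm_apply (tendsto_clm_apply hB hp) hp
  exact ((h1.mul h4).add ((h2.mul h3).mul (h5.add h6))).sub ((tendsto_const_nhds.mul h2).mul h7)

theorem tendsto_of_tendsto_uniformly {E F : Type*} [TopologicalSpace E] [NormedAddCommGroup F]
    {l : Filter ℝ} {S : Set E} {φ : ℝ → E → F} {u : E → F} {x : ℝ → E} {x₀ : E}
    (hlim : ∀ η > 0, ∀ᶠ δ in l, ∀ z ∈ S, ‖φ δ z - u z‖ ≤ η) (hu : ContinuousAt u x₀)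
    (hx : Tendsto x l (𝓝 x₀)) (hxS : ∀ᶠ δ in l, x δ ∈ S) :
    Tendsto (fun δ => φ δ (x δ)) l (𝓝 (u x₀)) := by
  have h1 : Tendsto (fun δ => φ δ (x δ) - u (x δ)) l (𝓝 0) := by
    rw [Metric.tendsto_nhds]
    intro η hη
    filter_upwards [hlim (η / 2) (by positivity), hxS] with δ h1 h2
    rw [dist_zero_right]
    linarith [h1 _ h2]
  simpa using h1.add (hu.tendsto.comp hx)

/-- The rays of the perturbed metrics need only converge to those of the background: the difference
quotients of the densities converge uniformly, and the dominated convergence theorem applies. -/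
theorem tendsto_integral_rayDensity {a : ℝ → ℝ} (ha : ContDiffOn ℝ ∞ a (Ioi 0))
    (ha_pos : ∀ t, 0 < t → 0 < a t) {t₀ t₁ m A A' B c T M : ℝ} (hs : SlabBounds a t₀ t₁ m A A')
    (hc : 0 < c) {v : Space} {u : ST → Form} {h : ℝ → ST → Form}
    (huC : ContDiffOn ℝ 2 u (future t₀))
    (huM : ∀ x ∈ future t₀, ‖u x‖ ≤ M ∧ ‖fderiv ℝ u x‖ ≤ M)
    (hlim : ∀ η > 0, ∀ᶠ δ in 𝓝[Icc 0 1 \ {0}] (0 : ℝ), ∀ x ∈ future t₀,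
      ‖δ⁻¹ • h δ x - u x‖ ≤ η ∧ ‖δ⁻¹ • fderiv ℝ (h δ) x - fderiv ℝ u x‖ ≤ η)
    {γ : ℝ → ℝ → ST} {I : ℝ → Set ℝ} {s e : ℝ → ℝ} {γ₀ : ℝ → ST} {I₀ : Set ℝ} {s₀ : ℝ}
    (hγ : ∀ᶠ δ in 𝓝[Icc 0 1 \ {0}] (0 : ℝ),
      ReachesSurface a t₀ t₁ v B c (e δ) (γ δ) (I δ) (s δ) ∧
      (∀ r ∈ I δ, DifferentiableAt ℝ (γ δ) r) ∧ γ δ 0 = γ₀ 0 ∧ s δ ≤ T ∧ 0 ≤ e δ ∧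
      ContinuousOn (rayDensity a (h δ) (γ δ)) (Icc 0 (s δ)))
    (he : Tendsto e (𝓝[Icc 0 1 \ {0}] (0 : ℝ)) (𝓝 0))
    (hγ₀ : ReachesSurface a t₀ t₁ v B c 0 γ₀ I₀ s₀) (hγ₀d : ∀ r ∈ I₀, DifferentiableAt ℝ γ₀ r) :
    Tendsto (fun δ => δ⁻¹ * ∫ r in Ioo 0 (s δ), rayDensity a (h δ) (γ δ) r)
      (𝓝[Icc 0 1 \ {0}] (0 : ℝ)) (𝓝 (∫ r in Ioo 0 s₀, rayDensity a u γ₀ r)) := by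
  have hnC := contDiffOn_nullField ha ha_pos t₁ v
  obtain ⟨K, hK⟩ := (hnC.mono fun t ht => hs.pos.trans_le ht.1).exists_lipschitzOnWith (by simp)
    (convex_Icc t₀ (t₁ + 1)) isCompact_Icc
  have hdist : ∀ᶠ δ in 𝓝[Icc 0 1 \ {0}] (0 : ℝ),
      (∀ r ∈ Icc 0 (min (s δ) s₀), dist (γ δ r) (γ₀ r) ≤ gronwallBound 0 K (e δ) T) ∧
        c * |s δ - s₀| ≤ gronwallBound 0 K (e δ) T := by
    filter_upwards [hγ] with δ ⟨h1, h2, h3, h4, h5, _⟩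
    have := h1.dist_le h5 le_rfl hK h2 hγ₀ hγ₀d h3 ((min_le_left _ _).trans h4)
    rwa [add_zero] at this
  have hβ : Tendsto (fun δ => gronwallBound 0 K (e δ) T) (𝓝[Icc 0 1 \ {0}] (0 : ℝ)) (𝓝 0) := by
    have := ((gronwallBound_continuous_ε 0 K T).tendsto 0).comp he
    rwa [gronwallBound_ε0_δ0] at this
  have hsT : Tendsto s (𝓝[Icc 0 1 \ {0}] (0 : ℝ)) (𝓝 s₀) := by
    rw [tendsto_iff_dist_tendsto_zero]
    refine squeeze_zero' (Eventually.of_forall fun _ => dist_nonneg) ?_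
      (by simpa using hβ.div_const c)
    filter_upwards [hdist] with δ hδ
    rw [Real.dist_eq, le_div_iff₀ hc, mul_comm]
    exact hδ.2
  have hconv : ∀ r ∈ Ioo 0 s₀, Tendsto (fun δ => δ⁻¹ * rayDensity a (h δ) (γ δ) r)
      (𝓝[Icc 0 1 \ {0}] (0 : ℝ)) (𝓝 (rayDensity a u γ₀ r)) := by
    intro r hr
    have hrs : ∀ᶠ δ in 𝓝[Icc 0 1 \ {0}] (0 : ℝ), r < s δ := hsT.eventually_const_lt hr.2
    have hmem₀ := hγ₀.mem r (Ioo_subset_Ico_self hr)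
    have hpos := hs.pos.trans hmem₀.1
    have hx : Tendsto (fun δ => γ δ r) (𝓝[Icc 0 1 \ {0}] (0 : ℝ)) (𝓝 (γ₀ r)) := by
      rw [tendsto_iff_dist_tendsto_zero]
      refine squeeze_zero' (Eventually.of_forall fun _ => dist_nonneg) ?_ hβ
      filter_upwards [hdist, hrs] with δ hδ hrδ
      exact hδ.1 r ⟨hr.1.le, le_min hrδ.le hr.2.le⟩
    have ht : Tendsto (fun δ => (γ δ r).1) (𝓝[Icc 0 1 \ {0}] (0 : ℝ)) (𝓝 (γ₀ r).1) :=
      (continuous_fst.tendsto _).comp hx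
    have hp : Tendsto (fun δ => deriv (γ δ) r) (𝓝[Icc 0 1 \ {0}] (0 : ℝ)) (𝓝 (deriv γ₀ r)) := by
      have h0 : deriv γ₀ r = nullField a t₁ v (γ₀ r).1 :=
        sub_eq_zero.1 (norm_le_zero_iff.1 (hγ₀.close r (Ioo_subset_Ico_self hr)))
      have h1 : Tendsto (fun δ => nullField a t₁ v (γ δ r).1) (𝓝[Icc 0 1 \ {0}] (0 : ℝ))
          (𝓝 (deriv γ₀ r)) := by
        rw [h0]
        exact (hnC.continuousOn.continuousAt (Ioi_mem_nhds hpos)).tendsto.comp ht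
      have h2 : Tendsto (fun δ => deriv (γ δ) r - nullField a t₁ v (γ δ r).1)
          (𝓝[Icc 0 1 \ {0}] (0 : ℝ)) (𝓝 0) := by
        refine squeeze_zero_norm' ?_ he
        filter_upwards [hγ, hrs] with δ hδ hrδ
        exact hδ.1.close r ⟨hr.1.le, hrδ⟩
      simpa using h2.add h1
    have hfut : ∀ᶠ δ in 𝓝[Icc 0 1 \ {0}] (0 : ℝ), γ δ r ∈ future t₀ := by
      filter_upwards [hγ, hrs] with δ hδ hrδ
      exact (hδ.1.mem r ⟨hr.1.le, hrδ⟩).1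
    have hS := (isOpen_future t₀).mem_nhds (show γ₀ r ∈ future t₀ from hmem₀.1)
    have hB := tendsto_of_tendsto_uniformly (φ := fun δ z => δ⁻¹ • h δ z)
      (fun η hη => (hlim η hη).mono fun δ hδ z hz => (hδ z hz).1)
      (huC.continuousOn.continuousAt hS) hx hfut
    have hB' := tendsto_of_tendsto_uniformly (φ := fun δ z => δ⁻¹ • fderiv ℝ (h δ) z)
      (fun η hη => (hlim η hη).mono fun δ hδ z hz => (hδ z hz).2)
      ((huC.continuousOn_fderiv_of_isOpen (isOpen_future t₀) (by norm_num)).continuousAt hS) hx hfut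
    have hfin := tendsto_conformalQuad (ha.continuousOn.continuousAt (Ioi_mem_nhds hpos))
      ((ha.continuousOn_deriv_of_isOpen isOpen_Ioi (by simp)).continuousAt (Ioi_mem_nhds hpos))
      ht hB hB' hp
    simpa only [conformalQuad_smul] using! hfin
  have hmain := tendsto_integral_filter_of_dominated_convergence (μ := volume)
    (l := 𝓝[Icc 0 1 \ {0}] (0 : ℝ))
    (F := fun δ => (Ioo 0 (s δ)).indicator fun r => δ⁻¹ * rayDensity a (h δ) (γ δ) r)
    (f := (Ioo 0 s₀).indicator (rayDensity a u γ₀))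
    ((Ioo 0 T).indicator fun _ => (A + 4 * A') * (M + 1) * B ^ 2) ?_ ?_ ?_ ?_
  · simp_rw [integral_indicator measurableSet_Ioo, integral_const_mul] at hmain
    exact hmain
  · filter_upwards [hγ] with δ hδ
    exact (aestronglyMeasurable_indicator_iff measurableSet_Ioo).2
      (((hδ.2.2.2.2.2.mono Ioo_subset_Icc_self).const_mul δ⁻¹ :
        ContinuousOn (fun r => δ⁻¹ * rayDensity a (h δ) (γ δ) r) _).aestronglyMeasurable
        measurableSet_Ioo)
  · filter_upwards [hγ, hlim 1 one_pos, self_mem_nhdsWithin] with δ hδ hl hδm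
    have hδ0 : 0 < δ := lt_of_le_of_ne hδm.1.1 (Ne.symm hδm.2)
    refine Eventually.of_forall fun r => ?_
    by_cases hr : r ∈ Ioo 0 (s δ)
    · have hr' : r ∈ Ico 0 (s δ) := Ioo_subset_Ico_self hr
      have hmem := hδ.1.mem r hr'
      have hIcc : (γ δ r).1 ∈ Icc t₀ (t₁ + 1) := ⟨hmem.1.le, by linarith [hmem.2]⟩
      rw [indicator_of_mem hr, indicator_of_mem (Ioo_subset_Ioo_right hδ.2.2.2.1 hr), rayDensity,
        ← conformalQuad_smul]
      exact abs_conformalQuad_le (hs.abs_a_le hIcc) (hs.deriv_le _ hIcc)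
        (norm_le_of_norm_inv_smul_sub_le hδ0 (huM _ hmem.1).1 (hl _ hmem.1).1).1
        (norm_le_of_norm_inv_smul_sub_le hδ0 (huM _ hmem.1).2 (hl _ hmem.1).2).1
        (hδ.1.norm_le r hr')
    · rw [indicator_of_notMem hr, norm_zero]
      have hA := hs.A_pos
      have hA' := hs.A'_nonneg
      have hM : 0 ≤ M := (norm_nonneg _).trans
        (huM _ (hγ₀.mem 0 ⟨le_rfl, hγ₀.pos⟩).1).1
      exact indicator_nonneg (fun _ _ => by positivity) r
  · exact (integrable_indicator_iff measurableSet_Ioo).2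
      (integrableOn_const (by simp [Real.volume_Ioo]))
  -- the parameter `s₀` is excluded: there the indicators need not converge
  · filter_upwards [Measure.ae_ne volume s₀] with r hrs
    by_cases hr0 : 0 < r
    · rcases lt_or_gt_of_ne hrs with hlt | hgt
      · rw [indicator_of_mem (show r ∈ Ioo 0 s₀ from ⟨hr0, hlt⟩)]
        refine (hconv r ⟨hr0, hlt⟩).congr' ?_
        filter_upwards [hsT.eventually_const_lt hlt] with δ hδ
        rw [indicator_of_mem (show r ∈ Ioo 0 (s δ) from ⟨hr0, hδ⟩)]
      · rw [indicator_of_notMem (show r ∉ Ioo 0 s₀ from fun hmem => absurd hmem.2 (not_lt.2 hgt.le))]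
        refine tendsto_const_nhds.congr' ?_
        filter_upwards [hsT.eventually_lt_const hgt] with δ hδ
        rw [indicator_of_notMem (show r ∉ Ioo 0 (s δ) from
          fun hmem => absurd hmem.2 (not_lt.2 hδ.le))]
    · rw [indicator_of_notMem (show r ∉ Ioo 0 s₀ from fun hmem => hr0 hmem.1)]
      refine tendsto_const_nhds.congr fun δ => ?_
      rw [indicator_of_notMem (show r ∉ Ioo 0 (s δ) from fun hmem => hr0 hmem.1)]

end CMB

end

/-! ### The derivative of the redshift -/

open CMB Set Filter MeasureTheory

theorem theorem4p2
    (a : ℝ → ℝ) (ha : ContDiffOn ℝ ∞ a (Set.Ioi 0)) (ha_pos : ∀ t : ℝ, 0 < t → 0 < a t)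
    (t₀ t₁ : ℝ) (ht₀ : 0 < t₀) (ht₁ : t₀ < t₁)
    (U₁ : Set CMB.Space) (hU₁ : Bornology.IsBounded U₁)
    (g : ℝ → CMB.ST → CMB.Form)
    (hg_smooth : ∀ ε ∈ Set.Icc (0 : ℝ) 1, ContDiffOn ℝ 2 (g ε) CMB.spacetime)
    (hg_lorentz : ∀ ε ∈ Set.Icc (0 : ℝ) 1, ∀ x ∈ CMB.spacetime, CMB.IsLorentzForm (g ε x))
    (hg_zero : ∀ x ∈ CMB.spacetime, g 0 x = CMB.flrw a x)
    (hg_diff : CMB.CbTwoDifferentiableOn (Set.Icc 0 1) (CMB.future t₀)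
      (fun ε x => g ε x - CMB.flrw a x))
    (hg_obs : ∀ ε ∈ Set.Icc (0 : ℝ) 1, ∀ y ∈ U₁, g ε (t₁, y) = CMB.flrw a (t₁, y))
    (hg_surf : ∀ ε ∈ Set.Icc (0 : ℝ) 1, ∀ x ∈ CMB.surface t₀, g ε x = CMB.flrw a x) :
    -- the first hitting parameters, hence the redshifts, are well defined for small `ε`
    (∀ᶠ ε in 𝓝[Set.Icc 0 1] (0 : ℝ), ∀ y ∈ U₁, ∀ v ∈ Metric.sphere (0 : CMB.Space) 1,
      IsLeast (CMB.hits (g ε) t₀ (t₁, y) (CMB.direction a t₁ v))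
        (CMB.hitTime (g ε) t₀ (t₁, y) (CMB.direction a t₁ v))) ∧
    -- the Lie derivative exists in the classical sense off the surfaces `t = t₀` and `t = t₁`
    (∀ x ∈ CMB.spacetime, x.1 ≠ t₀ → x.1 ≠ t₁ →
      DifferentiableAt ℝ (CMB.scaleDown a (CMB.cutoffDeriv t₀ t₁ g)) x) ∧
    ∀ y ∈ U₁, ∀ v ∈ Metric.sphere (0 : CMB.Space) 1,
      -- the integral defining the light ray transform converges
      MeasureTheory.IntegrableOn
        (CMB.rayIntegrand (CMB.flrw a) (CMB.conformalLie a (CMB.cutoffDeriv t₀ t₁ g))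
          (t₁, y) (CMB.direction a t₁ v))
        (CMB.geodesicDomain (CMB.flrw a) (t₁, y) (CMB.direction a t₁ v)) ∧
      HasDerivWithinAt (fun ε => CMB.redshift a t₀ t₁ (g ε) y v)
        (1 / (2 * a t₀) *
          CMB.lightRay a t₁ (CMB.conformalLie a (CMB.cutoffDeriv t₀ t₁ g)) y v)
        (Set.Icc 0 1) 0 := by

  obtain ⟨m, A, A', hs⟩ := exists_slabBounds ha ha_pos ht₀ ht₁
  have ht₁' : 0 < t₁ := ht₀.trans ht₁
  have ha0 := ha_pos t₀ ht₀
  have h01 : (0 : ℝ) ∈ Icc (0 : ℝ) 1 := ⟨le_rfl, zero_le_one⟩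
  have hmet : ∀ ε ∈ Icc (0 : ℝ) 1, IsMetric (g ε) := fun ε hε =>
    ⟨hg_smooth ε hε, fun x hx => (hg_lorentz ε hε x hx).1, fun x hx u hu =>
      (hg_lorentz ε hε x hx).eq_zero hu⟩
  have hF : IsMetric (flrw a) :=
    ⟨(hg_smooth 0 h01).congr fun x hx => (hg_zero x hx).symm,
      fun x hx => hg_zero x hx ▸ (hg_lorentz 0 h01 x hx).1,
      fun x hx u hu => (hg_lorentz 0 h01 x hx).eq_zero (by rwa [hg_zero x hx])⟩
  have hfs : future t₀ ⊆ spacetime := fun x hx => ht₀.trans hx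
  obtain ⟨u, M, huC, hM0, huM, hlim⟩ := hg_diff.exists_tendsto_uniformly (isOpen_future t₀)
    fun x hx => by rw [hg_zero x (hfs hx), sub_self]
  have hu := derivWithin_eq_of_tendsto_uniformly (fun z hz => hg_zero z (hfs hz)) fun η hη =>
    (hlim η hη).mono fun δ hδ z hz => (hδ z hz).1
  obtain ⟨B, c, C, T, η, hc, hC, hη, hctrl⟩ := exists_uniform_control hs
  -- the perturbed metrics are close to the background, at a linear rate in `ε`
  have hclose0 : IsClose a t₀ (g 0) 0 := fun x hx => by
    have h1 : (fun x => g 0 x - flrw a x) =ᶠ[𝓝 x] 0 := by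
      filter_upwards [isOpen_spacetime.mem_nhds (hfs hx)] with z hz
      rw [hg_zero z hz, sub_self, Pi.zero_apply]
    refine ⟨by rw [hg_zero x (hfs hx), sub_self, norm_zero], ?_⟩
    rw [h1.fderiv_eq, fderiv_zero, Pi.zero_apply, norm_zero]
  have hclose : ∀ᶠ ε in 𝓝[Icc 0 1 \ {0}] (0 : ℝ), IsClose a t₀ (g ε) ((M + 1) * ε) := by
    filter_upwards [hlim 1 one_pos, self_mem_nhdsWithin] with ε hl hε x hx
    have hε0 : 0 < ε := lt_of_le_of_ne hε.1.1 (Ne.symm hε.2)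
    exact ⟨(norm_le_of_norm_inv_smul_sub_le hε0 (huM x hx).1 (hl x hx).1).2,
      (norm_le_of_norm_inv_smul_sub_le hε0 (huM x hx).2 (hl x hx).2).2⟩
  have hlin : Tendsto (fun ε : ℝ => (M + 1) * ε) (𝓝[Icc 0 1 \ {0}] 0) (𝓝 0) := by
    have : Tendsto (fun ε : ℝ => (M + 1) * ε) (𝓝 0) (𝓝 ((M + 1) * 0)) :=
      (continuous_const.mul continuous_id).tendsto 0
    rw [mul_zero] at this
    exact this.mono_left nhdsWithin_le_nhds
  have hsmall : ∀ᶠ ε in 𝓝[Icc 0 1 \ {0}] (0 : ℝ), (M + 1) * ε ≤ η :=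
    (hlin.eventually_lt_const hη).mono fun _ h => h.le
  have hnorm : ∀ v ∈ Metric.sphere (0 : Space) 1, ‖v‖ = 1 := fun v hv => by simpa using hv
  refine ⟨?_, ?_, ?_⟩
  · rw [← insert_sdiff_self_of_mem h01, nhdsWithin_insert, eventually_sup, eventually_pure]
    refine ⟨fun y hy v hv => ?_, ?_⟩
    · exact (hctrl (g 0) 0 (hmet 0 h01) hclose0 hη.le y v (hnorm v hv) (hg_obs 0 h01 y hy)).2.1
    · filter_upwards [hclose, hsmall, self_mem_nhdsWithin] with ε h1 h2 hε y hy v hv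
      exact (hctrl (g ε) _ (hmet ε hε.1) h1 h2 y v (hnorm v hv) (hg_obs ε hε.1 y hy)).2.1
  · intro x hx hx0 hx1
    have had := hs.differentiableAt x.1 hx
    have hane := (ha_pos x.1 hx).ne'
    by_cases hmem : x.1 ∈ Ioo t₀ t₁
    · have hux : DifferentiableAt ℝ u x :=
        (huC.contDiffAt ((isOpen_future t₀).mem_nhds hmem.1)).differentiableAt (by norm_num)
      exact (hasFDerivAt_scaleDown had hane
        (hux.congr_of_eventuallyEq (cutoffDeriv_eventuallyEq hu hmem))).differentiableAt
    · have hmem' : x.1 ∉ Icc t₀ t₁ := fun h =>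
        hmem ⟨lt_of_le_of_ne h.1 (Ne.symm hx0), lt_of_le_of_ne h.2 hx1⟩
      exact (hasFDerivAt_scaleDown had hane ((differentiableAt_const 0).congr_of_eventuallyEq
        (cutoffDeriv_eventuallyEq_zero g hmem'))).differentiableAt
  · intro y hy v hv
    have hv1 := hnorm v hv
    -- the ray of the background
    have hcloseF : IsClose a t₀ (flrw a) 0 := fun x hx => by simp
    obtain ⟨hgeo, hleast, hT, hreach⟩ := hctrl (flrw a) 0 hF hcloseF hη.le y v hv1 rfl
    rw [mul_zero] at hreach
    have hsub := hreach.subset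
    have hcont : ContinuousOn (rayDensity a u (geodesic (flrw a) (t₁, y) (direction a t₁ v)))
        (Ioo 0 (hitTime (flrw a) t₀ (t₁, y) (direction a t₁ v))) :=
      continuousOn_rayDensity ha (isOpen_future t₀) huC
        (fun r hr => (hgeo.2.2.2.1 r
          (hsub (Ioo_subset_Icc_self hr))).2.1.continuousAt.continuousWithinAt)
        (fun r hr => (hgeo.2.2.2.1 r
          (hsub (Ioo_subset_Icc_self hr))).2.2.1.continuousAt.continuousWithinAt)
        (fun r hr => (hreach.mem r (Ioo_subset_Ico_self hr)).1)
        (fun r hr => (hgeo.2.2.2.1 r (hsub (Ioo_subset_Icc_self hr))).1)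
    have hint : IntegrableOn (rayDensity a u (geodesic (flrw a) (t₁, y) (direction a t₁ v)))
        (Ioo 0 (hitTime (flrw a) t₀ (t₁, y) (direction a t₁ v))) := by
      refine IntegrableOn.of_bound (by simp) (hcont.aestronglyMeasurable measurableSet_Ioo)
        ((A + 4 * A') * M * B ^ 2) ?_
      refine (ae_restrict_iff' measurableSet_Ioo).2 (Eventually.of_forall fun r hr => ?_)
      have hmem := hreach.mem r (Ioo_subset_Ico_self hr)
      have hIcc : (geodesic (flrw a) (t₁, y) (direction a t₁ v) r).1 ∈ Icc t₀ (t₁ + 1) :=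
        ⟨hmem.1.le, by linarith [hmem.2]⟩
      exact abs_conformalQuad_le (hs.abs_a_le hIcc) (hs.deriv_le _ hIcc) (huM _ hmem.1).1
        (huM _ hmem.1).2 (hreach.norm_le r (Ioo_subset_Ico_self hr))
    obtain ⟨hI, hL⟩ := lightRay_eq ha ha_pos hF ht₀ ht₁ huC hu hv1 hgeo
      (hsub ⟨hreach.pos.le, le_rfl⟩) hreach.eq hint
    refine ⟨hI, ?_⟩
    rw [hL, hasDerivWithinAt_iff_tendsto_slope]
    -- the rays of the perturbed metrics
    have hpert := ((hclose.and hsmall).and self_mem_nhdsWithin).mono fun ε h =>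
      And.intro h.2 (hctrl (g ε) _ (hmet ε h.2.1) h.1.1 h.1.2 y v hv1 (hg_obs ε h.2.1 y hy))
    have hlimit := tendsto_integral_rayDensity ha ha_pos hs hc huC huM hlim
      (γ := fun ε => geodesic (g ε) (t₁, y) (direction a t₁ v))
      (I := fun ε => geodesicDomain (g ε) (t₁, y) (direction a t₁ v))
      (s := fun ε => hitTime (g ε) t₀ (t₁, y) (direction a t₁ v))
      (e := fun ε => C * ((M + 1) * ε)) (T := T) (by
        filter_upwards [hpert] with ε ⟨hε, h1, h2, h3, h4⟩
        refine ⟨h4, fun r hr => (h1.2.2.2.1 r hr).2.1, ?_, h3, ?_,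
          (redshift_eq ha ha_pos ht₀ ht₁ (hmet ε hε.1) hF hv1 (hg_obs ε hε.1 y hy) h1 h4).1⟩
        · rw [h1.2.2.2.2.1, hgeo.2.2.2.2.1]
        · have := hε.1.1
          positivity)
      (by simpa using hlin.const_mul C) hreach fun r hr => (hgeo.2.2.2.1 r hr).2.1
    -- at `ε = 0` the density vanishes
    have hR0 : redshift a t₀ t₁ (g 0) y v = a t₁ / a t₀ - 1 := by
      obtain ⟨h1, -, -, h4⟩ := hctrl (g 0) 0 (hmet 0 h01) hclose0 hη.le y v hv1 (hg_obs 0 h01 y hy)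
      rw [(redshift_eq ha ha_pos ht₀ ht₁ (hmet 0 h01) hF hv1 (hg_obs 0 h01 y hy) h1 h4).2,
        setIntegral_eq_zero_of_forall_eq_zero, zero_div, add_zero]
      intro r hr
      have hmem := h4.mem r (Ioo_subset_Ico_self hr)
      obtain ⟨k1, k2⟩ := hclose0 _ hmem.1
      have k1' := norm_le_zero_iff.1 k1
      have k2' := norm_le_zero_iff.1 k2
      rw [rayDensity, k1', k2']
      simp [conformalQuad]
    refine ((hlimit.const_mul (1 / (2 * a t₀))).congr' ?_)
    filter_upwards [hpert] with ε ⟨hε, h1, _, _, h4⟩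
    rw [slope_def_field, hR0,
      (redshift_eq ha ha_pos ht₀ ht₁ (hmet ε hε.1) hF hv1 (hg_obs ε hε.1 y hy) h1 h4).2]
    have hε0 : ε ≠ 0 := hε.2
    field_simp
    ring
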